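/- **The algorithm.** There are $N\ge 1$ sub-queues (Michael–Scott queues with atomic, failable enqueue and dequeue), each of whose nodes carries a *row* number. The *tail row* of a sub-queue is the row of its last node, and its *head row* is the row of its current dummy node, i.e. of the node dequeued last (both are $0$ initially). Shared objects, each read or compare-and-swapped (CAS) atomically, are: the tail window $W^{tail}=(max,depth,width,next\_width)$, the head window $W^{head}=(max,depth,width)$, a *Lateral* queue (again a Michael–Scott queue) of nodes $(row,width)$, and variables $depth_{shared}\ge1$ and $1\le width_{shared}\le N$ that are changed arbitrarily from outside at any time. For a window $W$ put $W.min=W.max-W.depth$. Initially, for some $d\ge 1$ and $1\le w\le N$, $depth_{shared}=d$, $width_{shared}=w$, $W^{tail}=(d,d,w,w)$, $W^{head}=(d,d,w)$, and all queues are empty; the dummy node of the Lateral has row $0$. Threads run enqueues and dequeues concurrently with arbitrary interleaving. *Enqueue.* Read $W=W^{tail}$ and look for a sub-queue with index below $W.width$ and tail row $r<W.max$; try to link the item there, directly behind the last node seen, at row $\max(W.min,r)+1$. If all these sub-queues were seen with tail row $\ge W.max$, shift the tail window and restart: if $W.width\ne W.next\_width$ and the last Lateral node has row $\le W.max$, try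 to link $(W.max+1,\,W.next\_width)$ directly behind that node; then read $depth_{shared}$ and $width_{shared}$ and CAS $W^{tail}$ from $W$ to $(W.max+depth_{shared},\ depth_{shared},\ W.next\_width,\ width_{shared})$. *Dequeue.* Read $W=W^{head}$ and look for a non-empty sub-queue with index below $W.width$ and head row $<W.max$; try to dequeue its first item. If all sub-queues with index below $W.width$ were seen with head row $\ge W.max$, shift the head window and restart: remove Lateral nodes from the front as long as their row is $\le W.max$; read $W^{tail}.max$ (give up the shift if it is $\le W.max$) and $depth_{shared}$ and put $m=\min(W^{tail}.max,\ W.max+depth_{shared})$; then look at the first remaining Lateral node: if it exists and has row $W.max+1$, the new width is its width and one proceeds to the next Lateral node, otherwise the new width is $W.width$; if the Lateral node now considered exists and has row $\rho\le m$, replace $m$ by $\rho-1$; finally CAS $W^{head}$ from $W$ to $(m,\ m-W.max,\ \text{new width})$. A dequeue returns "empty" if two successive collects over all sub-queues with index below $W.width$ found all of them empty and unchanged, and afterwards $W^{tail}.max=W.max$. **Theorem.** Every finite concurrent history of this elastic Lateral-plus-Window 2D queue is linearizable with respect to a FIFO queue with elastic $k$ out-of-order relaxed dequeues, that is, a queue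 in which an enqueue appends an item at the end, a dequeue that returns an item $x$ removes $x$ from a position with at most $k$ items in front of it, and a dequeue may report "empty" only when the queue is empty; here, for the dequeue of $x$, $$k=(W^{enq\,x}.width-1)\,(W^{enq\,x}.depth+W^{deq\,x}.depth-1),$$ where $W^{enq\,x}$ is the tail window at the moment $x$ is linked into its sub-queue and $W^{deq\,x}$ is the head window at the moment $x$ is removed from its sub-queue. -/

import Mathlib

/-! # The elastic Lateral-plus-Window 2D queue as a shared-memory transition system

`N` is the number of sub-queues that are created at initialisation, `T` the type of threads and
`α` the type of values.  Every transition is one atomic action of one thread (a read of one shared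
object, or a compare-and-swap on one shared object), or an arbitrary change of the two shared
configuration variables.  Transitions of different threads interleave arbitrarily. -/

namespace ElasticQueue

/-- The shared window of the enqueuers.  Its rows are `max - depth + 1, …, max`. -/
structure TailWindow where
  max : ℕ
  depth : ℕ
  width : ℕ
  nextWidth : ℕ

/-- The shared window of the dequeuers.  Its rows are `max - depth + 1, …, max`. -/
structure HeadWindow where
  max : ℕ
  depth : ℕ
  width : ℕ

/-- A node of the Lateral: from `row` on, the rows have width `width`. -/
structure LateralNode where
  row : ℕ
  width : ℕ

/-- Operations are identified by the position of their invocation in the history. -/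
abbrev OpId := ℕ

/-- A node of a sub-queue.  The field `op` is only a mark used to state the specification: it
identifies the item by the operation that enqueued it, and no transition depends on it. -/
structure Node (α : Type*) where
  val : α
  row : ℕ
  op : OpId

/-- A Michael–Scott sub-queue.  `nodes` are all nodes that were ever linked, in order, and the first
`removed` of them have been dequeued.  The node dequeued last serves as the dummy node. -/
structure SubQueue (α : Type*) where
  nodes : List (Node α)
  removed : ℕ

/-- Row of the last node of a list (`0`, the row of the initial dummy node, for the empty list). -/
def lastRow {α : Type*} (l : List (Node α)) : ℕ := (l.getLast?.map Node.row).getD 0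

namespace SubQueue

variable {α : Type*}

/-- The row that the enqueues of the sub-queue have reached. -/
def tailRow (q : SubQueue α) : ℕ := lastRow q.nodes

/-- The row that the dequeues of the sub-queue have reached: the row of the current dummy node. -/
def headRow (q : SubQueue α) : ℕ := lastRow (q.nodes.take q.removed)

/-- There is no node behind the current dummy node. -/
def IsEmpty (q : SubQueue α) : Prop := q.nodes.length ≤ q.removed

/-- Link a node at the end. -/
def link (q : SubQueue α) (x : Node α) : SubQueue α := { q with nodes := q.nodes ++ [x] }

/-- Move the dummy node one step forward. -/
def unlink (q : SubQueue α) : SubQueue α := { q with removed := q.removed + 1 }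

end SubQueue

/-- Operations of the queue. -/
inductive Op (α : Type*) where
  | enq (v : α)
  | deq

/-- Results: `ack` of an enqueue, `item v` of a dequeue of an item with value `v`, and `empty` of a
dequeue that reports the queue to be empty. -/
inductive Ret (α : Type*) where
  | ack
  | item (v : α)
  | empty

/-- Events of a history.  `inv` and `ret` are the invocations and responses.  The other two are
marks that record in which window an item was enqueued or dequeued: `inserted e W` when operation `e`
links its node while the tail window is `W`, and `taken d e W` when operation `d` unlinks the node of
operation `e` while the head window is `W`. -/
inductive Event (T α : Type*) where
  | inv (t : T) (o : Op α)
  | ret (p : OpId) (r : Ret α)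
  | inserted (e : OpId) (W : TailWindow)
  | taken (d e : OpId) (W : HeadWindow)

/-- Local state of a thread (program counter and local variables).  `p` is the current operation, `v`
the value to be enqueued and `W` the local copy of the tail or head window. -/
inductive Local (N : ℕ) (α : Type*) where
  /-- No pending operation. -/
  | idle
  /-- Operation `p` has its result `r` and is about to return. -/
  | done (p : OpId) (r : Ret α)
  /-- Enqueue: about to read the tail window. -/
  | enqStart (p : OpId) (v : α)
  /-- Enqueue: searching; the sub-queues in `full` were seen to have reached `W.max`. -/
  | enqSearch (p : OpId) (v : α) (W : TailWindow) (full : Set (Fin N))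
  /-- Enqueue: about to link a node behind the `n`-th and last seen node of sub-queue `i`. -/
  | enqTry (p : OpId) (v : α) (W : TailWindow) (full : Set (Fin N)) (i : Fin N) (n : ℕ)
  /-- ShiftTail: about to read the tail of the Lateral. -/
  | tailSync (p : OpId) (v : α) (W : TailWindow)
  /-- ShiftTail: about to link a Lateral node behind the last seen one, when there were `n`. -/
  | tailLink (p : OpId) (v : α) (W : TailWindow) (n : ℕ)
  /-- ShiftTail: about to read the shared depth. -/
  | tailDepth (p : OpId) (v : α) (W : TailWindow)
  /-- ShiftTail: about to read the shared width. -/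
  | tailWidth (p : OpId) (v : α) (W : TailWindow) (d : ℕ)
  /-- ShiftTail: about to replace the tail window `W` by `W'`. -/
  | tailCas (p : OpId) (v : α) (W W' : TailWindow)
  /-- Dequeue: about to read the head window. -/
  | deqStart (p : OpId)
  /-- Dequeue: searching; the sub-queues in `full` were seen to have reached `W.max`. -/
  | deqSearch (p : OpId) (W : HeadWindow) (full : Set (Fin N))
  /-- Dequeue: about to unlink from sub-queue `i`, in which `n` nodes were seen removed. -/
  | deqTry (p : OpId) (W : HeadWindow) (full : Set (Fin N)) (i : Fin N) (n : ℕ)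
  /-- Dequeue, first collect: `c i = some n` if sub-queue `i` was seen empty after `n` removals. -/
  | collect (p : OpId) (W : HeadWindow) (c : Fin N → Option ℕ)
  /-- Dequeue, second collect: the sub-queues in `again` were seen empty and unchanged. -/
  | recollect (p : OpId) (W : HeadWindow) (c : Fin N → Option ℕ) (again : Set (Fin N))
  /-- ShiftHead: about to read the head of the Lateral. -/
  | headClean (p : OpId) (W : HeadWindow)
  /-- ShiftHead: about to remove the stale node behind the Lateral's dummy node `h`. -/
  | headPop (p : OpId) (W : HeadWindow) (h : ℕ)
  /-- ShiftHead: about to read the max of the tail window. -/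
  | headTail (p : OpId) (W : HeadWindow) (h : ℕ)
  /-- ShiftHead: about to read the shared depth; the max of the tail window was `M`. -/
  | headDepth (p : OpId) (W : HeadWindow) (h M : ℕ)
  /-- ShiftHead: about to look whether a width change starts right above `W`. -/
  | headWidth (p : OpId) (W : HeadWindow) (h m : ℕ)
  /-- ShiftHead: about to cut the new window below the next width change. -/
  | headLimit (p : OpId) (W : HeadWindow) (h m w : ℕ)
  /-- ShiftHead: about to replace the head window `W` by `W'`. -/
  | headCas (p : OpId) (W W' : HeadWindow)

/-- Global state: shared memory, local states of the threads, and the history so far (which no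
thread ever reads). -/
structure State (T : Type*) (N : ℕ) (α : Type*) where
  tail : TailWindow
  head : HeadWindow
  /-- All nodes ever linked into the Lateral, in order; node `0` is the initial dummy node. -/
  lat : List LateralNode
  /-- Position in `lat` of the current dummy node of the Lateral. -/
  latHead : ℕ
  sub : Fin N → SubQueue α
  depthShared : ℕ
  widthShared : ℕ
  loc : T → Local N α
  hist : List (Event T α)

/-- Initial state with depth `d` and width `w`: all sub-queues and the Lateral are empty, no
operation is pending, and both windows consist of the rows `1, …, d`. -/
def initial (T : Type*) (N : ℕ) (α : Type*) (d w : ℕ) : State T N α where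
  tail := ⟨d, d, w, w⟩
  head := ⟨d, d, w⟩
  lat := [⟨0, w⟩]
  latHead := 0
  sub := fun _ => ⟨[], 0⟩
  depthShared := d
  widthShared := w
  loc := fun _ => .idle
  hist := []

namespace State

variable {T : Type*} [DecidableEq T] {N : ℕ} {α : Type*}

/-- Thread `t` moves to the local state `l`. -/
def goto (s : State T N α) (t : T) (l : Local N α) : State T N α :=
  { s with loc := Function.update s.loc t l }

/-- Append an event to the history. -/
def log (s : State T N α) (e : Event T α) : State T N α := { s with hist := s.hist ++ [e] }

/-- Replace sub-queue `i` by `q`. -/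
def setSub (s : State T N α) (i : Fin N) (q : SubQueue α) : State T N α :=
  { s with sub := Function.update s.sub i q }

end State

/-- The window is completely explored: all sub-queues with index below `width` are in `S`. -/
def Covers {N : ℕ} (S : Set (Fin N)) (width : ℕ) : Prop := ∀ i : Fin N, i.val < width → i ∈ S

/-- The atomic transitions of the elastic Lateral-plus-Window 2D queue. -/
inductive Step {T : Type*} [DecidableEq T] {N : ℕ} {α : Type*} :
    State T N α → State T N α → Prop
  /- The configuration is changed from outside, at any time. -/
  | configure (s : State T N α) (d w : ℕ) (hd : 1 ≤ d) (hw : 1 ≤ w) (hN : w ≤ N) :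
      Step s { s with depthShared := d, widthShared := w }
  /- Invocations and responses. -/
  | invokeEnq (s : State T N α) (t : T) (v : α) (h : s.loc t = .idle) :
      Step s ((s.goto t (.enqStart s.hist.length v)).log (.inv t (.enq v)))
  | invokeDeq (s : State T N α) (t : T) (h : s.loc t = .idle) :
      Step s ((s.goto t (.deqStart s.hist.length)).log (.inv t .deq))
  | respond (s : State T N α) (t : T) (p : OpId) (r : Ret α) (h : s.loc t = .done p r) :
      Step s ((s.goto t .idle).log (.ret p r))
  /- Enqueue.  Sub-queues inside the window are inspected in any order; a search may be given up at
  any time in order to read the window again. -/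
  | enqRead (s : State T N α) (t : T) (p : OpId) (v : α) (h : s.loc t = .enqStart p v) :
      Step s (s.goto t (.enqSearch p v s.tail ∅))
  | enqRestart (s : State T N α) (t : T) (p : OpId) (v : α) (W : TailWindow) (full : Set (Fin N))
      (h : s.loc t = .enqSearch p v W full) :
      Step s (s.goto t (.enqStart p v))
  | enqSeeFull (s : State T N α) (t : T) (p : OpId) (v : α) (W : TailWindow) (full : Set (Fin N))
      (i : Fin N) (h : s.loc t = .enqSearch p v W full) (hi : i.val < W.width)
      (hrow : W.max ≤ (s.sub i).tailRow) :
      Step s (s.goto t (.enqSearch p v W (insert i full)))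
  | enqSeeRoom (s : State T N α) (t : T) (p : OpId) (v : α) (W : TailWindow) (full : Set (Fin N))
      (i : Fin N) (h : s.loc t = .enqSearch p v W full) (hi : i.val < W.width)
      (hrow : (s.sub i).tailRow < W.max) :
      Step s (s.goto t (.enqTry p v W full i (s.sub i).nodes.length))
  | enqSucceed (s : State T N α) (t : T) (p : OpId) (v : α) (W : TailWindow) (full : Set (Fin N))
      (i : Fin N) (n : ℕ) (h : s.loc t = .enqTry p v W full i n)
      (hn : (s.sub i).nodes.length = n) :
      Step s (((s.goto t (.done p .ack)).setSub i
        ((s.sub i).link ⟨v, max (W.max - W.depth) (s.sub i).tailRow + 1, p⟩)).log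
          (.inserted p s.tail))
  | enqFail (s : State T N α) (t : T) (p : OpId) (v : α) (W : TailWindow) (full : Set (Fin N))
      (i : Fin N) (n : ℕ) (h : s.loc t = .enqTry p v W full i n)
      (hn : (s.sub i).nodes.length ≠ n) :
      Step s (s.goto t (.enqSearch p v W full))
  /- ShiftTail, called when all sub-queues in the window were seen to have reached its max. -/
  | shiftTailSync (s : State T N α) (t : T) (p : OpId) (v : α) (W : TailWindow)
      (full : Set (Fin N)) (h : s.loc t = .enqSearch p v W full) (hfull : Covers full W.width)
      (hw : W.width ≠ W.nextWidth) :
      Step s (s.goto t (.tailSync p v W))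
  | shiftTailNoSync (s : State T N α) (t : T) (p : OpId) (v : α) (W : TailWindow)
      (full : Set (Fin N)) (h : s.loc t = .enqSearch p v W full) (hfull : Covers full W.width)
      (hw : W.width = W.nextWidth) :
      Step s (s.goto t (.tailDepth p v W))
  | tailSyncNeeded (s : State T N α) (t : T) (p : OpId) (v : α) (W : TailWindow) (l : LateralNode)
      (h : s.loc t = .tailSync p v W) (hl : s.lat.getLast? = some l) (hrow : l.row ≤ W.max) :
      Step s (s.goto t (.tailLink p v W s.lat.length))
  | tailSyncUnneeded (s : State T N α) (t : T) (p : OpId) (v : α) (W : TailWindow)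
      (l : LateralNode) (h : s.loc t = .tailSync p v W) (hl : s.lat.getLast? = some l)
      (hrow : W.max < l.row) :
      Step s (s.goto t (.tailDepth p v W))
  | tailLinkSucceed (s : State T N α) (t : T) (p : OpId) (v : α) (W : TailWindow) (n : ℕ)
      (h : s.loc t = .tailLink p v W n) (hn : s.lat.length = n) :
      Step s { s.goto t (.tailDepth p v W) with lat := s.lat ++ [⟨W.max + 1, W.nextWidth⟩] }
  | tailLinkFail (s : State T N α) (t : T) (p : OpId) (v : α) (W : TailWindow) (n : ℕ)
      (h : s.loc t = .tailLink p v W n) (hn : s.lat.length ≠ n) :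
      Step s (s.goto t (.tailDepth p v W))
  | tailReadDepth (s : State T N α) (t : T) (p : OpId) (v : α) (W : TailWindow)
      (h : s.loc t = .tailDepth p v W) :
      Step s (s.goto t (.tailWidth p v W s.depthShared))
  | tailReadWidth (s : State T N α) (t : T) (p : OpId) (v : α) (W : TailWindow) (d : ℕ)
      (h : s.loc t = .tailWidth p v W d) :
      Step s (s.goto t (.tailCas p v W ⟨W.max + d, d, W.nextWidth, s.widthShared⟩))
  | tailCasSucceed (s : State T N α) (t : T) (p : OpId) (v : α) (W W' : TailWindow)
      (h : s.loc t = .tailCas p v W W') (hW : s.tail = W) :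
      Step s { s.goto t (.enqStart p v) with tail := W' }
  | tailCasFail (s : State T N α) (t : T) (p : OpId) (v : α) (W W' : TailWindow)
      (h : s.loc t = .tailCas p v W W') (hW : s.tail ≠ W) :
      Step s (s.goto t (.enqStart p v))
  /- Dequeue.  Sub-queues inside the window are inspected in any order; a search may be given up at
  any time in order to read the window again.  (A sub-queue that is seen empty below the max of the
  window leaves the local state unchanged.) -/
  | deqRead (s : State T N α) (t : T) (p : OpId) (h : s.loc t = .deqStart p) :
      Step s (s.goto t (.deqSearch p s.head ∅))
  | deqRestart (s : State T N α) (t : T) (p : OpId) (W : HeadWindow) (full : Set (Fin N))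
      (h : s.loc t = .deqSearch p W full) :
      Step s (s.goto t (.deqStart p))
  | deqSeeFull (s : State T N α) (t : T) (p : OpId) (W : HeadWindow) (full : Set (Fin N))
      (i : Fin N) (h : s.loc t = .deqSearch p W full) (hi : i.val < W.width)
      (hrow : W.max ≤ (s.sub i).headRow) :
      Step s (s.goto t (.deqSearch p W (insert i full)))
  | deqSeeItem (s : State T N α) (t : T) (p : OpId) (W : HeadWindow) (full : Set (Fin N))
      (i : Fin N) (h : s.loc t = .deqSearch p W full) (hi : i.val < W.width)
      (hrow : (s.sub i).headRow < W.max) (hne : ¬ (s.sub i).IsEmpty) :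
      Step s (s.goto t (.deqTry p W full i (s.sub i).removed))
  | deqSucceed (s : State T N α) (t : T) (p : OpId) (W : HeadWindow) (full : Set (Fin N))
      (i : Fin N) (n : ℕ) (x : Node α) (h : s.loc t = .deqTry p W full i n)
      (hn : (s.sub i).removed = n) (hx : (s.sub i).nodes[n]? = some x) :
      Step s (((s.goto t (.done p (.item x.val))).setSub i (s.sub i).unlink).log
        (.taken p x.op s.head))
  | deqFail (s : State T N α) (t : T) (p : OpId) (W : HeadWindow) (full : Set (Fin N))
      (i : Fin N) (n : ℕ) (h : s.loc t = .deqTry p W full i n) (hn : (s.sub i).removed ≠ n) :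
      Step s (s.goto t (.deqSearch p W full))
  /- Empty returns: two collects over the window that see the same empty sub-queues, followed by
  the test that the head window and the tail window have the same max. -/
  | collectStart (s : State T N α) (t : T) (p : OpId) (W : HeadWindow) (full : Set (Fin N))
      (h : s.loc t = .deqSearch p W full) :
      Step s (s.goto t (.collect p W (fun _ => none)))
  | collectSee (s : State T N α) (t : T) (p : OpId) (W : HeadWindow) (c : Fin N → Option ℕ)
      (i : Fin N) (h : s.loc t = .collect p W c) (hi : i.val < W.width) (hc : c i = none)
      (he : (s.sub i).IsEmpty) :
      Step s (s.goto t (.collect p W (Function.update c i (some (s.sub i).removed))))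
  | collectAbort (s : State T N α) (t : T) (p : OpId) (W : HeadWindow) (c : Fin N → Option ℕ)
      (h : s.loc t = .collect p W c) :
      Step s (s.goto t (.deqStart p))
  | recollectStart (s : State T N α) (t : T) (p : OpId) (W : HeadWindow) (c : Fin N → Option ℕ)
      (h : s.loc t = .collect p W c) (hc : Covers {i | c i ≠ none} W.width) :
      Step s (s.goto t (.recollect p W c ∅))
  | recollectSee (s : State T N α) (t : T) (p : OpId) (W : HeadWindow) (c : Fin N → Option ℕ)
      (again : Set (Fin N)) (i : Fin N) (h : s.loc t = .recollect p W c again)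
      (hi : i.val < W.width) (he : (s.sub i).IsEmpty) (hc : c i = some (s.sub i).removed) :
      Step s (s.goto t (.recollect p W c (insert i again)))
  | recollectAbort (s : State T N α) (t : T) (p : OpId) (W : HeadWindow) (c : Fin N → Option ℕ)
      (again : Set (Fin N)) (h : s.loc t = .recollect p W c again) :
      Step s (s.goto t (.deqStart p))
  | returnEmpty (s : State T N α) (t : T) (p : OpId) (W : HeadWindow) (c : Fin N → Option ℕ)
      (again : Set (Fin N)) (h : s.loc t = .recollect p W c again)
      (hall : Covers again W.width) (hmax : W.max = s.tail.max) :
      Step s (s.goto t (.done p .empty))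
  /- ShiftHead, called when all sub-queues in the window were seen to have reached its max.  First
  the Lateral nodes inside or below the window are removed, then the tail window and the shared depth
  are read, and then the first remaining Lateral nodes are compared with the new window. -/
  | shiftHead (s : State T N α) (t : T) (p : OpId) (W : HeadWindow) (full : Set (Fin N))
      (h : s.loc t = .deqSearch p W full) (hfull : Covers full W.width) :
      Step s (s.goto t (.headClean p W))
  | headSeeStale (s : State T N α) (t : T) (p : OpId) (W : HeadWindow) (l : LateralNode)
      (h : s.loc t = .headClean p W) (hl : s.lat[s.latHead + 1]? = some l)
      (hrow : l.row ≤ W.max) :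
      Step s (s.goto t (.headPop p W s.latHead))
  | headSeeClean (s : State T N α) (t : T) (p : OpId) (W : HeadWindow)
      (h : s.loc t = .headClean p W)
      (hl : ∀ l, s.lat[s.latHead + 1]? = some l → W.max < l.row) :
      Step s (s.goto t (.headTail p W s.latHead))
  | headPopSucceed (s : State T N α) (t : T) (p : OpId) (W : HeadWindow) (n : ℕ)
      (h : s.loc t = .headPop p W n) (hn : s.latHead = n) :
      Step s { s.goto t (.headClean p W) with latHead := n + 1 }
  | headPopFail (s : State T N α) (t : T) (p : OpId) (W : HeadWindow) (n : ℕ)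
      (h : s.loc t = .headPop p W n) (hn : s.latHead ≠ n) :
      Step s (s.goto t (.headClean p W))
  /- The head window does not move when it has caught up with the tail window. -/
  | headCaughtUp (s : State T N α) (t : T) (p : OpId) (W : HeadWindow) (n : ℕ)
      (h : s.loc t = .headTail p W n) (hmax : s.tail.max ≤ W.max) :
      Step s (s.goto t (.deqStart p))
  | headReadTail (s : State T N α) (t : T) (p : OpId) (W : HeadWindow) (n : ℕ)
      (h : s.loc t = .headTail p W n) (hmax : W.max < s.tail.max) :
      Step s (s.goto t (.headDepth p W n s.tail.max))
  | headReadDepth (s : State T N α) (t : T) (p : OpId) (W : HeadWindow) (n M : ℕ)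
      (h : s.loc t = .headDepth p W n M) :
      Step s (s.goto t (.headWidth p W n (min M (W.max + s.depthShared))))
  | headWidthChange (s : State T N α) (t : T) (p : OpId) (W : HeadWindow) (n m : ℕ)
      (l : LateralNode) (h : s.loc t = .headWidth p W n m) (hl : s.lat[n + 1]? = some l)
      (hrow : l.row = W.max + 1) :
      Step s (s.goto t (.headLimit p W (n + 1) m l.width))
  | headWidthKeep (s : State T N α) (t : T) (p : OpId) (W : HeadWindow) (n m : ℕ)
      (h : s.loc t = .headWidth p W n m)
      (hl : ∀ l, s.lat[n + 1]? = some l → l.row ≠ W.max + 1) :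
      Step s (s.goto t (.headLimit p W n m W.width))
  | headLimitCut (s : State T N α) (t : T) (p : OpId) (W : HeadWindow) (n m w : ℕ)
      (l : LateralNode) (h : s.loc t = .headLimit p W n m w) (hl : s.lat[n + 1]? = some l)
      (hrow : l.row ≤ m) :
      Step s (s.goto t (.headCas p W ⟨l.row - 1, l.row - 1 - W.max, w⟩))
  | headLimitKeep (s : State T N α) (t : T) (p : OpId) (W : HeadWindow) (n m w : ℕ)
      (h : s.loc t = .headLimit p W n m w)
      (hl : ∀ l, s.lat[n + 1]? = some l → m < l.row) :
      Step s (s.goto t (.headCas p W ⟨m, m - W.max, w⟩))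
  | headCasSucceed (s : State T N α) (t : T) (p : OpId) (W W' : HeadWindow)
      (h : s.loc t = .headCas p W W') (hW : s.head = W) :
      Step s { s.goto t (.deqStart p) with head := W' }
  | headCasFail (s : State T N α) (t : T) (p : OpId) (W W' : HeadWindow)
      (h : s.loc t = .headCas p W W') (hW : s.head ≠ W) :
      Step s (s.goto t (.deqStart p))

/-- `H` is the history of a finite execution that starts with depth `d` and width `w`. -/
def IsHistory {T : Type*} [DecidableEq T] (N : ℕ) {α : Type*} (d w : ℕ) (H : List (Event T α)) :
    Prop :=
  ∃ s : State T N α, Relation.ReflTransGen Step (initial T N α d w) s ∧ s.hist = H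

/-! ## Linearizability and the relaxed FIFO queue -/

/-- Real-time order: operation `p` returns before operation `q` is invoked. -/
def Precedes {T α : Type*} (H : List (Event T α)) (p q : OpId) : Prop :=
  ∃ (i : ℕ) (r : Ret α), H[i]? = some (.ret p r) ∧ i < q

/-- Linearizability with respect to a set `legal` of sequential executions: there is a legal
sequential execution that contains every completed operation with its actual result, possibly some
pending operations, each operation at most once and nothing else, and respects the real-time
order. -/
def Linearizable {T α : Type*} (H : List (Event T α)) (legal : List (OpId × Ret α) → Prop) : Prop :=
  ∃ L : List (OpId × Ret α),
    (L.map Prod.fst).Nodup ∧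
    (∀ x ∈ L, ∃ t o, H[x.1]? = some (.inv t o)) ∧
    (∀ p r, Event.ret p r ∈ H → (p, r) ∈ L) ∧
    L.Pairwise (fun a b => ¬ Precedes H b.1 a.1) ∧
    legal L

/-- One step of the FIFO queue with elastic out-of-order dequeues.  The state is the list of the
items in the queue, oldest first, an item being named by the operation that enqueues it.  `op` says
which operation a name stands for, and `bound e d k` that a dequeue `d` of item `e` may skip
at most `k` items. -/
inductive RelaxedStep {α : Type*} (op : OpId → Op α → Prop) (bound : OpId → OpId → ℤ → Prop) :
    List OpId → OpId × Ret α → List OpId → Prop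
  | enq (Q : List OpId) (p : OpId) (v : α) (hp : op p (.enq v)) :
      RelaxedStep op bound Q (p, .ack) (Q ++ [p])
  | deq (Q₁ Q₂ : List OpId) (e p : OpId) (v : α) (k : ℤ) (hp : op p .deq) (he : op e (.enq v))
      (hk : bound e p k) (hlen : (Q₁.length : ℤ) ≤ k) :
      RelaxedStep op bound (Q₁ ++ e :: Q₂) (p, .item v) (Q₁ ++ Q₂)
  | empty (p : OpId) (hp : op p .deq) : RelaxedStep op bound [] (p, .empty) []

/-- Sequential runs of the relaxed FIFO queue. -/
inductive RelaxedRun {α : Type*} (op : OpId → Op α → Prop) (bound : OpId → OpId → ℤ → Prop) :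
    List OpId → List (OpId × Ret α) → List OpId → Prop
  | nil (Q : List OpId) : RelaxedRun op bound Q [] Q
  | cons (Q Q' Q'' : List OpId) (x : OpId × Ret α) (L : List (OpId × Ret α))
      (h : RelaxedStep op bound Q x Q') (hL : RelaxedRun op bound Q' L Q'') :
      RelaxedRun op bound Q (x :: L) Q''

/-- The legal sequential executions of the FIFO queue with elastic out-of-order dequeues. -/
def RelaxedFifo {α : Type*} (op : OpId → Op α → Prop) (bound : OpId → OpId → ℤ → Prop)
    (L : List (OpId × Ret α)) : Prop :=
  ∃ Q, RelaxedRun op bound [] L Q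

/-- In history `H`, `p` is an invocation of `o`. -/
def Invokes {T α : Type*} (H : List (Event T α)) (p : OpId) (o : Op α) : Prop :=
  ∃ t, H[p]? = some (.inv t o)

/-- Item `e` was enqueued in the tail window `We` and dequeued by operation `d` in the head window
`Wd`, and `k = (We.width - 1) * (We.depth + Wd.depth - 1)`. -/
def RankBound {T α : Type*} (H : List (Event T α)) (e d : OpId) (k : ℤ) : Prop :=
  ∃ (We : TailWindow) (Wd : HeadWindow),
    Event.inserted e We ∈ H ∧ Event.taken d e Wd ∈ H ∧
      k = ((We.width : ℤ) - 1) * ((We.depth : ℤ) + (Wd.depth : ℤ) - 1)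

end ElasticQueue

/-! A linearization `L` is built along the execution and kept in the invariant `Inv`. An enqueue
takes effect when its node is linked and a successful dequeue when the node is unlinked; the
abstract queue `Q` lists the present items in the order of linking.

The rank bound counts cells of a grid. A ghost function `wd` gives every row a width, fixed for good
once the row belongs to a tail window. A node of sub-queue `i` in row `r` satisfies `i < wd r`, a
sub-queue has at most one node per row, and it leaves no gaps (`sub_full`). Hence a dequeued item
`x`, the first of its sub-queue, lies in the current head window (`MemInv.row_le_head`). This window
and the tail window in which `x` was enqueued share the row of `x`, hence their width. An item in
front of `x` is still present, so it lies above the min of the head window; it was linked before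
`x`, so it does not lie above the max of the enqueue window; and it is in another sub-queue. This
leaves `width - 1` columns and, because the windows overlap, at most the sum of the two depths minus
one rows (`QueueInv.length_le`).

The count requires that a head window never straddles a change of width. This is what the Lateral is
for: the tail window moves only after a pending change is recorded (`Synced`), so every change of
`wd` carries a Lateral node (`wd_succ`), and head windows are cut below the next one.

Threads work on outdated copies, so their local assertions must survive the steps of others; `Grows`
summarizes these steps. Window maxima strictly increase when windows change, and lengths and removal
counts never decrease, so a successful CAS certifies that its premises still hold.

An empty dequeue takes effect when its second collect starts. At that moment either the collect is
already doomed, for a reason that persists (`RecollectFails`), or `Q` is empty. In the second case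
the answer is entered in `L` tentatively and deleted if the collect is given up; deletion is
harmless because an empty answer does not change the queue. -/

namespace ElasticQueue

/-! ### Rows of a sorted list of nodes -/

section Rows

variable {α : Type*}

theorem lastRow_concat (l : List (Node α)) (x : Node α) : lastRow (l ++ [x]) = x.row := by
  simp [lastRow]

/-- Positivity of the bound covers the empty list, whose last row is `0` by default. -/
theorem lastRow_lt {l : List (Node α)} {b : ℕ} (hb : 0 < b) (h : ∀ x ∈ l, x.row < b) :
    lastRow l < b := by
  rcases List.eq_nil_or_concat' l with rfl | ⟨l', x, rfl⟩
  · simpa [lastRow] using hb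
  · rw [lastRow_concat]
    exact h x (by simp)

theorem le_lastRow {l : List (Node α)} (hs : l.Pairwise fun a b => a.row < b.row) {x : Node α}
    (hx : x ∈ l) : x.row ≤ lastRow l := by
  rcases List.eq_nil_or_concat' l with rfl | ⟨l', y, rfl⟩
  · simp at hx
  · rw [lastRow_concat]
    rw [List.pairwise_append] at hs
    rcases List.mem_append.1 hx with h | h
    · exact (hs.2.2 x h y (by simp)).le
    · rw [List.mem_singleton.1 h]

theorem lastRow_take_lt {l : List (Node α)} (hs : l.Pairwise fun a b => a.row < b.row) {n : ℕ}
    {y : Node α} (hy : y ∈ l.drop n) (hpos : 0 < y.row) : lastRow (l.take n) < y.row := by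
  rw [← List.take_append_drop n l, List.pairwise_append] at hs
  exact lastRow_lt hpos fun x hx => hs.2.2 x hx y hy

theorem take_succ_of_getElem? {l : List (Node α)} {n : ℕ} {x : Node α} (hx : l[n]? = some x) :
    l.take (n + 1) = l.take n ++ [x] := by
  rw [List.take_add_one, hx]; rfl

theorem drop_of_getElem? {l : List (Node α)} {n : ℕ} {x : Node α} (hx : l[n]? = some x) :
    l.drop n = x :: l.drop (n + 1) := by
  obtain ⟨h, rfl⟩ := List.getElem?_eq_some_iff.1 hx
  exact List.drop_eq_getElem_cons h

end Rows

/-! ### Sequential runs and histories -/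

section Runs

variable {T α : Type*}

theorem RelaxedStep.mono {op op' : OpId → Op α → Prop} {bound bound' : OpId → OpId → ℤ → Prop}
    (hop : ∀ p o, op p o → op' p o) (hb : ∀ e d k, bound e d k → bound' e d k)
    {Q Q' : List OpId} {x : OpId × Ret α} (h : RelaxedStep op bound Q x Q') :
    RelaxedStep op' bound' Q x Q' := by
  cases h with
  | enq => exact .enq _ _ _ (hop _ _ ‹_›)
  | deq Q₁ Q₂ e p v k hp he hk hlen =>
    exact .deq Q₁ Q₂ e p v k (hop _ _ hp) (hop _ _ he) (hb _ _ _ hk) hlen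
  | empty p hp => exact .empty p (hop _ _ hp)

theorem RelaxedRun.mono {op op' : OpId → Op α → Prop} {bound bound' : OpId → OpId → ℤ → Prop}
    (hop : ∀ p o, op p o → op' p o) (hb : ∀ e d k, bound e d k → bound' e d k)
    {Q Q' : List OpId} {L : List (OpId × Ret α)} (h : RelaxedRun op bound Q L Q') :
    RelaxedRun op' bound' Q L Q' := by
  induction h with
  | nil Q => exact .nil Q
  | cons Q Q' Q'' x L h _ ih => exact .cons Q Q' Q'' x L (h.mono hop hb) ih

theorem RelaxedRun.concat {op : OpId → Op α → Prop} {bound : OpId → OpId → ℤ → Prop}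
    {Q Q' Q'' : List OpId} {L : List (OpId × Ret α)} {x : OpId × Ret α}
    (h : RelaxedRun op bound Q L Q') (hx : RelaxedStep op bound Q' x Q'') :
    RelaxedRun op bound Q (L ++ [x]) Q'' := by
  induction h with
  | nil Q => exact .cons _ _ _ _ _ hx (.nil _)
  | cons Q Q' _ y L h _ ih => exact .cons _ _ _ _ _ h (ih hx)

/-- Operations that report the queue to be empty can be left out of a run. -/
theorem RelaxedRun.filter {op : OpId → Op α → Prop} {bound : OpId → OpId → ℤ → Prop}
    {Q Q' : List OpId} {L : List (OpId × Ret α)} {p : OpId} (h : RelaxedRun op bound Q L Q')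
    (hp : ∀ r, (p, r) ∈ L → r = .empty) :
    RelaxedRun op bound Q (L.filter fun x => x.1 ≠ p) Q' := by
  induction h with
  | nil Q => exact .nil Q
  | cons Q Q' Q'' x L h _ ih =>
    have ih := ih fun r hr => hp r (List.mem_cons_of_mem _ hr)
    by_cases hx : x.1 = p
    · obtain ⟨q, r⟩ := x
      obtain rfl : q = p := hx
      obtain rfl := hp r (by simp)
      rw [List.filter_cons_of_neg (by simp)]
      cases h
      exact ih
    · rw [List.filter_cons_of_pos (by simpa using hx)]
      exact .cons _ _ _ _ _ h ih

theorem Invokes.append {H : List (Event T α)} {p : OpId} {o : Op α} (h : Invokes H p o)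
    (E : List (Event T α)) : Invokes (H ++ E) p o := by
  obtain ⟨t, ht⟩ := h
  exact ⟨t, by rw [List.getElem?_append_left (List.getElem?_eq_some_iff.1 ht).1, ht]⟩

theorem RankBound.append {H : List (Event T α)} {e d : OpId} {k : ℤ} (h : RankBound H e d k)
    (E : List (Event T α)) : RankBound (H ++ E) e d k := by
  obtain ⟨We, Wd, h₁, h₂, h₃⟩ := h
  exact ⟨We, Wd, List.mem_append_left _ h₁, List.mem_append_left _ h₂, h₃⟩

/-- `L` is a linearization of the history `H` after which the queue consists of the items `Q`. -/
structure LinearizedBy (H : List (Event T α)) (L : List (OpId × Ret α)) (Q : List OpId) : Prop where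
  run : RelaxedRun (Invokes H) (RankBound H) [] L Q
  nodup : (L.map Prod.fst).Nodup
  inv : ∀ x ∈ L, ∃ o, Invokes H x.1 o
  ret : ∀ p r, Event.ret p r ∈ H → (p, r) ∈ L
  order : L.Pairwise fun a b => ¬ Precedes H b.1 a.1

namespace LinearizedBy

variable {H : List (Event T α)} {L : List (OpId × Ret α)} {Q : List OpId}

theorem nil : LinearizedBy ([] : List (Event T α)) [] [] :=
  ⟨.nil _, by simp, by simp, by simp, by simp⟩

theorem linearizable (h : LinearizedBy H L Q) :
    Linearizable H (RelaxedFifo (Invokes H) (RankBound H)) :=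
  ⟨L, h.nodup, fun x hx => by
    obtain ⟨o, t, ht⟩ := h.inv x hx
    exact ⟨t, o, ht⟩, h.ret, h.order, Q, h.run⟩

theorem lt_length (h : LinearizedBy H L Q) {p : OpId} {r : Ret α} (hp : (p, r) ∈ L) :
    p < H.length := by
  obtain ⟨o, t, ht⟩ := h.inv _ hp
  exact (List.getElem?_eq_some_iff.1 ht).1

/-- Operations are named by the positions of their invocations, so a response appended at the end
precedes no operation of `L` and adds no real-time constraint. -/
theorem log (h : LinearizedBy H L Q) (e : Event T α) (he : ∀ p r, e = .ret p r → (p, r) ∈ L) :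
    LinearizedBy (H ++ [e]) L Q where
  run := h.run.mono (fun _ _ hp => hp.append _) (fun _ _ _ hk => hk.append _)
  nodup := h.nodup
  inv x hx := by
    obtain ⟨o, ho⟩ := h.inv x hx
    exact ⟨o, ho.append _⟩
  ret p r hr := by
    rcases List.mem_append.1 hr with hr | hr
    · exact h.ret p r hr
    · exact he p r (List.mem_singleton.1 hr).symm
  order := by
    refine h.order.imp_of_mem ?_
    rintro ⟨a, ra⟩ ⟨b, rb⟩ ha _ hab ⟨i, r, hi, hlt⟩
    have hlt : i < a := hlt
    have := h.lt_length ha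
    rw [List.getElem?_append_left (hlt.trans this)] at hi
    exact hab ⟨i, r, hi, hlt⟩

/-- An operation without a response precedes nothing, so it may be placed last. -/
theorem concat (h : LinearizedBy H L Q) {Q' : List OpId} {p : OpId} {r : Ret α} {o : Op α}
    (hstep : RelaxedStep (Invokes H) (RankBound H) Q (p, r) Q') (hp : Invokes H p o)
    (hret : ∀ r, Event.ret p r ∉ H) (hL : ∀ r, (p, r) ∉ L) :
    LinearizedBy H (L ++ [(p, r)]) Q' where
  run := h.run.concat hstep
  nodup := by
    rw [List.map_append, List.nodup_append]
    refine ⟨h.nodup, by simp, ?_⟩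
    rintro _ ha _ hb rfl
    obtain ⟨⟨a, ra⟩, hmem, rfl⟩ := List.mem_map.1 ha
    simp only [List.map_cons, List.map_nil, List.mem_singleton] at hb
    subst hb
    exact hL _ hmem
  inv x hx := by
    rcases List.mem_append.1 hx with hx | hx
    · exact h.inv x hx
    · rw [List.mem_singleton.1 hx]
      exact ⟨o, hp⟩
  ret q r hr := List.mem_append_left _ (h.ret q r hr)
  order := by
    refine List.pairwise_append.2 ⟨h.order, by simp, ?_⟩
    rintro a _ b hb ⟨i, r', hi, _⟩
    rw [List.mem_singleton.1 hb] at hi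
    exact hret r' (List.mem_of_getElem? hi)

/-- Retracts a tentative empty answer: no response requires it as long as `p` has not returned. -/
theorem filter (h : LinearizedBy H L Q) {p : OpId} (hp : (p, Ret.empty) ∈ L)
    (hret : ∀ r, Event.ret p r ∉ H) : LinearizedBy H (L.filter fun x => x.1 ≠ p) Q where
  run := h.run.filter fun r hr => by
    have := List.inj_on_of_nodup_map h.nodup hp hr rfl
    exact (Prod.ext_iff.1 this).2.symm
  nodup := h.nodup.sublist (List.filter_sublist.map _)
  inv x hx := h.inv x (List.mem_of_mem_filter hx)
  ret q r hr := by
    refine List.mem_filter.2 ⟨h.ret q r hr, ?_⟩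
    simp only [decide_eq_true_eq]
    rintro rfl
    exact hret r hr
  order := h.order.sublist List.filter_sublist

end LinearizedBy

end Runs

/-! ### Invariants of the shared memory and of the local states -/

section Memory

variable {T α : Type*} {N : ℕ}

/-- All sub-queues inside the tail window `W` have reached its max. -/
def TailFull (s : State T N α) (W : TailWindow) : Prop :=
  ∀ i : Fin N, i.val < W.width → W.max ≤ (s.sub i).tailRow

/-- All sub-queues inside the head window `W` have been dequeued up to its max. -/
def HeadFull (s : State T N α) (W : HeadWindow) : Prop :=
  ∀ i : Fin N, i.val < W.width → W.max ≤ (s.sub i).headRow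

/-- The width change above the tail window `W`, if there is one, is in the Lateral. -/
def Synced (s : State T N α) (W : TailWindow) : Prop :=
  W.width ≠ W.nextWidth → ∃ l ∈ s.lat, l.row = W.max + 1

/-- `W` is the tail window or an earlier one. -/
def TailSeen (s : State T N α) (W : TailWindow) : Prop :=
  W = s.tail ∨ W.max < s.tail.max ∧ TailFull s W ∧ Synced s W

/-- `W` is the head window or an earlier one. -/
def HeadSeen (s : State T N α) (W : HeadWindow) : Prop :=
  W = s.head ∨ W.max < s.head.max ∧ HeadFull s W

/-- The nodes of the Lateral up to row `R` are those up to position `n`. -/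
def LatSplit (s : State T N α) (R n : ℕ) : Prop :=
  n < s.lat.length ∧ ∀ j l, s.lat[j]? = some l → (l.row ≤ R ↔ j ≤ n)

/-- Invariants of the shared memory, where `wd r` is the width of row `r`. -/
structure MemInv (wd : ℕ → ℕ) (s : State T N α) : Prop where
  depthShared_pos : 1 ≤ s.depthShared
  tail_pos : 1 ≤ s.tail.depth
  tail_le : s.tail.depth ≤ s.tail.max
  head_pos : 1 ≤ s.head.depth
  head_le : s.head.depth ≤ s.head.max
  head_le_tail : s.head.max ≤ s.tail.max
  wd_tail : ∀ r, s.tail.max - s.tail.depth < r → r ≤ s.tail.max → wd r = s.tail.width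
  wd_head : ∀ r, s.head.max - s.head.depth < r → r ≤ s.head.max → wd r = s.head.width
  lat_sorted : s.lat.Pairwise fun a b => a.row < b.row
  lat_le : ∀ l ∈ s.lat, l.row ≤ s.tail.max + 1
  lat_next : ∀ l ∈ s.lat, l.row = s.tail.max + 1 → l.width = s.tail.nextWidth
  lat_wd : ∀ l ∈ s.lat, l.row ≤ s.tail.max → wd l.row = l.width
  wd_succ : ∀ r, r + 1 ≤ s.tail.max → (∀ l ∈ s.lat, l.row ≠ r + 1) → wd (r + 1) = wd r
  latHead_lt : s.latHead < s.lat.length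
  latHead_row : ∀ j l, s.lat[j]? = some l → j ≤ s.latHead → l.row ≤ s.head.max
  sub_sorted : ∀ i, (s.sub i).nodes.Pairwise fun a b => a.row < b.row
  removed_le : ∀ i, (s.sub i).removed ≤ (s.sub i).nodes.length
  row_le : ∀ i, ∀ x ∈ (s.sub i).nodes, x.row ≤ s.tail.max
  lt_wd : ∀ i, ∀ x ∈ (s.sub i).nodes, i.val < wd x.row
  sub_full : ∀ (i : Fin N) (r : ℕ), 1 ≤ r →
    r ≤ (s.sub i).tailRow ∨ r ≤ s.tail.max - s.tail.depth → i.val < wd r →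
    ∃ x ∈ (s.sub i).nodes, x.row = r
  -- Only the width of the last row below the head window is used: a sub-queue outside that width
  -- may lag behind.
  head_full : ∀ i : Fin N, i.val < wd (s.head.max - s.head.depth) →
    s.head.max - s.head.depth ≤ (s.sub i).headRow
  head_lt : ∀ i, ∀ x ∈ (s.sub i).nodes.drop (s.sub i).removed,
    s.head.max - s.head.depth < x.row

/-- Invariants of the local state of a thread. -/
def LocInv (wd : ℕ → ℕ) (s : State T N α) : Local N α → Prop
  | .enqSearch _ _ W full => TailSeen s W ∧ ∀ i ∈ full, W.max ≤ (s.sub i).tailRow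
  | .enqTry _ _ W full i n => TailSeen s W ∧ (∀ i ∈ full, W.max ≤ (s.sub i).tailRow) ∧
      i.val < W.width ∧ n ≤ (s.sub i).nodes.length ∧
      ((s.sub i).nodes.length = n → (s.sub i).tailRow < W.max)
  | .tailSync _ _ W => TailSeen s W ∧ TailFull s W ∧ W.width ≠ W.nextWidth
  | .tailLink _ _ W n => TailSeen s W ∧ TailFull s W ∧ W.width ≠ W.nextWidth ∧
      n ≤ s.lat.length ∧ (s.lat.length = n → ∀ l ∈ s.lat, l.row ≤ W.max) ∧
      (s.lat.length ≠ n → ∃ l ∈ s.lat, l.row = W.max + 1)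
  | .tailDepth _ _ W => TailSeen s W ∧ TailFull s W ∧ Synced s W
  | .tailWidth _ _ W d => TailSeen s W ∧ TailFull s W ∧ Synced s W ∧ 1 ≤ d
  | .tailCas _ _ W W' => TailSeen s W ∧ TailFull s W ∧ Synced s W ∧ 1 ≤ W'.depth ∧
      W'.max = W.max + W'.depth ∧ W'.width = W.nextWidth
  | .deqSearch _ W full => HeadSeen s W ∧ ∀ i ∈ full, W.max ≤ (s.sub i).headRow
  | .deqTry _ W full i n => HeadSeen s W ∧ (∀ i ∈ full, W.max ≤ (s.sub i).headRow) ∧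
      i.val < W.width ∧ n ≤ (s.sub i).removed ∧
      ((s.sub i).removed = n → (s.sub i).headRow < W.max)
  | .collect _ W c => HeadSeen s W ∧ ∀ i k, c i = some k → k ≤ (s.sub i).removed
  | .headClean _ W => HeadSeen s W ∧ HeadFull s W
  | .headPop _ W h => HeadSeen s W ∧ HeadFull s W ∧ ∃ l, s.lat[h + 1]? = some l ∧ l.row ≤ W.max
  -- The Lateral position matters only while `W` is current; otherwise the final CAS fails.
  | .headTail _ W h => HeadSeen s W ∧ HeadFull s W ∧ (W = s.head → LatSplit s W.max h)
  | .headDepth _ W h M => HeadSeen s W ∧ HeadFull s W ∧ W.max < M ∧ M ≤ s.tail.max ∧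
      (W = s.head → LatSplit s W.max h)
  | .headWidth _ W h m => HeadSeen s W ∧ HeadFull s W ∧ W.max < m ∧ m ≤ s.tail.max ∧
      (W = s.head → LatSplit s W.max h)
  | .headLimit _ W h m w => HeadSeen s W ∧ HeadFull s W ∧ W.max < m ∧ m ≤ s.tail.max ∧
      (W = s.head → LatSplit s (W.max + 1) h ∧ w = wd (W.max + 1))
  | .headCas _ W W' => HeadSeen s W ∧ HeadFull s W ∧ (W = s.head → W.max < W'.max ∧
      W'.max ≤ s.tail.max ∧ W'.depth = W'.max - W.max ∧
      ∀ r, W.max < r → r ≤ W'.max → wd r = W'.width)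
  | _ => True

/-! ### Stability -/

/-- How a sub-queue changes. -/
structure SubGrows (q q' : SubQueue α) : Prop where
  length_le : q.nodes.length ≤ q'.nodes.length
  tailRow_le : q.tailRow ≤ q'.tailRow
  -- The length acts as a version number for the tail, and `removed` does so for the head.
  tailRow_eq : q'.nodes.length = q.nodes.length → q'.tailRow = q.tailRow
  removed_le : q.removed ≤ q'.removed
  headRow_le : q.headRow ≤ q'.headRow
  headRow_eq : q'.removed = q.removed → q'.headRow = q.headRow

theorem SubGrows.refl (q : SubQueue α) : SubGrows q q :=
  ⟨le_rfl, le_rfl, fun _ => rfl, le_rfl, le_rfl, fun _ => rfl⟩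

/-- How the shared memory changes. -/
structure Grows (wd wd' : ℕ → ℕ) (s s' : State T N α) : Prop where
  tail : s'.tail = s.tail ∨
    s.tail.max < s'.tail.max ∧ TailFull s' s.tail ∧ Synced s' s.tail
  head : s'.head = s.head ∨ s.head.max < s'.head.max ∧ HeadFull s' s.head
  lat : s'.lat = s.lat ∨ ∃ l, s'.lat = s.lat ++ [l] ∧ l.row = s.tail.max + 1
  sub : ∀ i, SubGrows (s.sub i) (s'.sub i)
  wd_eq : ∀ r ≤ s.tail.max, wd' r = wd r

namespace Grows

variable {wd wd' : ℕ → ℕ} {s s' : State T N α}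

theorem tail_max_le (g : Grows wd wd' s s') : s.tail.max ≤ s'.tail.max := by
  rcases g.tail with h | h
  · rw [h]
  · exact h.1.le

theorem tailFull (g : Grows wd wd' s s') {W : TailWindow} (h : TailFull s W) : TailFull s' W :=
  fun i hi => (h i hi).trans (g.sub i).tailRow_le

theorem headFull (g : Grows wd wd' s s') {W : HeadWindow} (h : HeadFull s W) : HeadFull s' W :=
  fun i hi => (h i hi).trans (g.sub i).headRow_le

theorem mem_lat (g : Grows wd wd' s s') {l : LateralNode} (h : l ∈ s.lat) : l ∈ s'.lat := by
  rcases g.lat with h' | ⟨l', h', _⟩ <;> rw [h']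
  · exact h
  · exact List.mem_append_left _ h

theorem exists_lat (g : Grows wd wd' s s') {P : LateralNode → Prop} (h : ∃ l ∈ s.lat, P l) :
    ∃ l ∈ s'.lat, P l := by
  obtain ⟨l, hl, hP⟩ := h
  exact ⟨l, g.mem_lat hl, hP⟩

theorem synced (g : Grows wd wd' s s') {W : TailWindow} (h : Synced s W) : Synced s' W :=
  fun hW => g.exists_lat (h hW)

theorem tailSeen (g : Grows wd wd' s s') {W : TailWindow} (h : TailSeen s W) : TailSeen s' W := by
  rcases h with rfl | ⟨h₁, h₂, h₃⟩
  · rcases g.tail with h | h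
    · exact .inl h.symm
    · exact .inr h
  · exact .inr ⟨h₁.trans_le g.tail_max_le, g.tailFull h₂, g.synced h₃⟩

theorem head_max_le (g : Grows wd wd' s s') : s.head.max ≤ s'.head.max := by
  rcases g.head with h | h
  · rw [h]
  · exact h.1.le

theorem headSeen (g : Grows wd wd' s s') {W : HeadWindow} (h : HeadSeen s W) : HeadSeen s' W := by
  rcases h with rfl | ⟨h₁, h₂⟩
  · rcases g.head with h | h
    · exact .inl h.symm
    · exact .inr h
  · exact .inr ⟨h₁.trans_le g.head_max_le, g.headFull h₂⟩

/-- Maxima of head windows strictly increase, so an outdated window never becomes current again (no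
ABA). -/
theorem head_eq (g : Grows wd wd' s s') {W : HeadWindow} (h : HeadSeen s W) (hW : W = s'.head) :
    W = s.head := by
  rcases h with h | h
  · exact h
  · have := g.head_max_le
    rw [← hW] at this
    omega

/-- A node appended to the Lateral has row `s.tail.max + 1`, which is above `R`. -/
theorem latSplit (g : Grows wd wd' s s') {R n : ℕ} (hR : R ≤ s.tail.max) (h : LatSplit s R n) :
    LatSplit s' R n := by
  obtain ⟨h₁, h₂⟩ := h
  rcases g.lat with h' | ⟨l', h', hl'⟩
  · rw [LatSplit, h']
    exact ⟨h₁, h₂⟩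
  · rw [LatSplit, h']
    refine ⟨by simp; omega, fun j l hj => ?_⟩
    rcases lt_or_ge j s.lat.length with hlt | hge
    · rw [List.getElem?_append_left hlt] at hj
      exact h₂ j l hj
    · rw [List.getElem?_append_right hge, List.getElem?_singleton] at hj
      split at hj
      · obtain rfl := Option.some.inj hj
        constructor <;> intro <;> omega
      · cases hj

/-- Interference freedom: each local assertion consists of bounds on growing quantities, of facts
guarded by an unchanged version number or window, and of facts about rows whose width is already
fixed. -/
theorem locInv (g : Grows wd wd' s s') (hs : MemInv wd s) {l : Local N α} (h : LocInv wd s l) :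
    LocInv wd' s' l := by
  have hle := hs.head_le_tail
  have htail := g.tail_max_le
  have hhead : ∀ {W : HeadWindow}, W = s.head → W.max ≤ s.tail.max := fun h => h ▸ hle
  cases l with
  | idle | done | enqStart | deqStart | recollect => trivial
  | enqSearch p v W full =>
    obtain ⟨h₁, h₂⟩ := h
    exact ⟨g.tailSeen h₁, fun i hi => (h₂ i hi).trans (g.sub i).tailRow_le⟩
  | enqTry p v W full i n =>
    obtain ⟨h₁, h₂, h₃, h₄, h₅⟩ := h
    refine ⟨g.tailSeen h₁, fun i hi => (h₂ i hi).trans (g.sub i).tailRow_le, h₃,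
      h₄.trans (g.sub i).length_le, fun hn => ?_⟩
    have := (g.sub i).length_le
    rw [(g.sub i).tailRow_eq (by omega)]
    exact h₅ (by omega)
  | tailSync p v W =>
    obtain ⟨h₁, h₂, h₃⟩ := h
    exact ⟨g.tailSeen h₁, g.tailFull h₂, h₃⟩
  | tailLink p v W n =>
    obtain ⟨h₁, h₂, h₃, h₄, h₅, h₆⟩ := h
    refine ⟨g.tailSeen h₁, g.tailFull h₂, h₃, ?_⟩
    rcases g.lat with h' | ⟨l', h', hl'⟩
    · rw [h']
      exact ⟨h₄, h₅, h₆⟩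
    · rw [h']
      refine ⟨by simp; omega, fun hn => by simp at hn; omega, fun _ => ?_⟩
      -- If this is the first growth since the length was read, the new node is the wanted one: were
      -- `W` outdated, it would be synced already, against the rows that were seen.
      by_cases hn : s.lat.length = n
      · refine ⟨l', by simp, ?_⟩
        rcases h₁ with rfl | ⟨_, _, hsync⟩
        · exact hl'
        · obtain ⟨l, hl, hrow⟩ := hsync h₃
          have := h₅ hn l hl
          omega
      · obtain ⟨l, hl, hrow⟩ := h₆ hn
        exact ⟨l, by simp [hl], hrow⟩
  | tailDepth p v W =>
    obtain ⟨h₁, h₂, h₃⟩ := h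
    exact ⟨g.tailSeen h₁, g.tailFull h₂, g.synced h₃⟩
  | tailWidth p v W d =>
    obtain ⟨h₁, h₂, h₃, h₄⟩ := h
    exact ⟨g.tailSeen h₁, g.tailFull h₂, g.synced h₃, h₄⟩
  | tailCas p v W W' =>
    obtain ⟨h₁, h₂, h₃, h₄⟩ := h
    exact ⟨g.tailSeen h₁, g.tailFull h₂, g.synced h₃, h₄⟩
  | deqSearch p W full =>
    obtain ⟨h₁, h₂⟩ := h
    exact ⟨g.headSeen h₁, fun i hi => (h₂ i hi).trans (g.sub i).headRow_le⟩
  | deqTry p W full i n =>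
    obtain ⟨h₁, h₂, h₃, h₄, h₅⟩ := h
    refine ⟨g.headSeen h₁, fun i hi => (h₂ i hi).trans (g.sub i).headRow_le, h₃,
      h₄.trans (g.sub i).removed_le, fun hn => ?_⟩
    have := (g.sub i).removed_le
    rw [(g.sub i).headRow_eq (by omega)]
    exact h₅ (by omega)
  | collect p W c =>
    obtain ⟨h₁, h₂⟩ := h
    exact ⟨g.headSeen h₁, fun i k hk => (h₂ i k hk).trans (g.sub i).removed_le⟩
  | headClean p W =>
    obtain ⟨h₁, h₂⟩ := h
    exact ⟨g.headSeen h₁, g.headFull h₂⟩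
  | headPop p W n =>
    obtain ⟨h₁, h₂, l, hl, hrow⟩ := h
    refine ⟨g.headSeen h₁, g.headFull h₂, l, ?_, hrow⟩
    rcases g.lat with h' | ⟨l', h', _⟩ <;> rw [h']
    · exact hl
    · rw [List.getElem?_append_left (List.getElem?_eq_some_iff.1 hl).1, hl]
  | headTail p W n =>
    obtain ⟨h₁, h₂, h₃⟩ := h
    refine ⟨g.headSeen h₁, g.headFull h₂, fun hW => ?_⟩
    have hW := g.head_eq h₁ hW
    exact g.latSplit (hhead hW) (h₃ hW)
  | headDepth p W n M =>
    obtain ⟨h₁, h₂, h₃, h₄, h₅⟩ := h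
    refine ⟨g.headSeen h₁, g.headFull h₂, h₃, h₄.trans htail, fun hW => ?_⟩
    have hW := g.head_eq h₁ hW
    exact g.latSplit (hhead hW) (h₅ hW)
  | headWidth p W n m =>
    obtain ⟨h₁, h₂, h₃, h₄, h₅⟩ := h
    refine ⟨g.headSeen h₁, g.headFull h₂, h₃, h₄.trans htail, fun hW => ?_⟩
    have hW := g.head_eq h₁ hW
    exact g.latSplit (hhead hW) (h₅ hW)
  | headLimit p W n m w =>
    obtain ⟨h₁, h₂, h₃, h₄, h₅⟩ := h
    refine ⟨g.headSeen h₁, g.headFull h₂, h₃, h₄.trans htail, fun hW => ?_⟩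
    have hW := g.head_eq h₁ hW
    have hm : W.max + 1 ≤ s.tail.max := by omega
    refine ⟨g.latSplit hm (h₅ hW).1, ?_⟩
    rw [g.wd_eq _ hm]
    exact (h₅ hW).2
  | headCas p W W' =>
    obtain ⟨h₁, h₂, h₃⟩ := h
    refine ⟨g.headSeen h₁, g.headFull h₂, fun hW => ?_⟩
    obtain ⟨h₄, h₅, h₆, h₇⟩ := h₃ (g.head_eq h₁ hW)
    refine ⟨h₄, h₅.trans htail, h₆, fun r hr hr' => ?_⟩
    rw [g.wd_eq _ (hr'.trans h₅)]
    exact h₇ r hr hr'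

end Grows

/-! ### Properties of the shared memory -/

theorem HeadSeen.max_le {s : State T N α} {W : HeadWindow} (h : HeadSeen s W) :
    W.max ≤ s.head.max := by
  rcases h with rfl | h
  · rfl
  · exact h.1.le

/-- A sub-queue with room in the window `W` proves that `W` is the current tail window. -/
theorem TailSeen.eq_tail {s : State T N α} {W : TailWindow} (h : TailSeen s W) {i : Fin N}
    (hi : i.val < W.width) (hrow : (s.sub i).tailRow < W.max) : W = s.tail := by
  rcases h with h | ⟨_, h, _⟩
  · exact h
  · exact absurd (h i hi) hrow.not_ge

/-- An outdated head window has been exhausted, which room in one of its sub-queues refutes. -/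
theorem HeadSeen.eq_head {s : State T N α} {W : HeadWindow} (h : HeadSeen s W) {i : Fin N}
    (hi : i.val < W.width) (hrow : (s.sub i).headRow < W.max) : W = s.head := by
  rcases h with h | ⟨_, h⟩
  · exact h
  · exact absurd (h i hi) hrow.not_ge

namespace MemInv

variable {wd : ℕ → ℕ} {s : State T N α}

/-- The width does not change between rows without a Lateral node. -/
theorem wd_const (hs : MemInv wd s) {a b : ℕ} (hab : a ≤ b) (hb : b ≤ s.tail.max)
    (hl : ∀ l ∈ s.lat, a < l.row → b < l.row) : wd b = wd a := by
  induction b, hab using Nat.le_induction with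
  | base => rfl
  | succ b hab ih =>
    rw [hs.wd_succ b hb fun l hl' h => by have := hl l hl' (by omega); omega]
    exact ih (by omega) fun l hl' h => by have := hl l hl' h; omega

theorem row_pos (hs : MemInv wd s) {i : Fin N} {x : Node α}
    (hx : x ∈ (s.sub i).nodes.drop (s.sub i).removed) : 0 < x.row :=
  (Nat.zero_le _).trans_lt (hs.head_lt i x hx)

theorem headRow_lt (hs : MemInv wd s) {i : Fin N} {x : Node α}
    (hx : x ∈ (s.sub i).nodes.drop (s.sub i).removed) : (s.sub i).headRow < x.row :=
  lastRow_take_lt (hs.sub_sorted i) hx (hs.row_pos hx)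

/-- The first item of a sub-queue in the head window lies in the head window. -/
theorem row_le_head (hs : MemInv wd s) {i : Fin N} {x : Node α} (hi : i.val < s.head.width)
    (hrow : (s.sub i).headRow < s.head.max)
    (hx : (s.sub i).nodes[(s.sub i).removed]? = some x) : x.row ≤ s.head.max := by
  by_contra! hlt
  have hp := hs.head_pos
  have hl := hs.head_le
  have hwd := hs.wd_head s.head.max (by omega) le_rfl
  -- If `x` were above the head window, the absence of gaps would yield a node `y` in row
  -- `s.head.max`. If `y` is removed, `headRow` is too large; if it is present, it would have to
  -- come before the first item `x`.
  obtain ⟨y, hy, hyrow⟩ := hs.sub_full i s.head.max (by omega)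
    (.inl (hlt.le.trans (le_lastRow (hs.sub_sorted i) (List.mem_of_getElem? hx)))) (by omega)
  have hsort := hs.sub_sorted i
  rw [← List.take_append_drop (s.sub i).removed (s.sub i).nodes] at hy hsort
  rw [List.pairwise_append] at hsort
  rcases List.mem_append.1 hy with hy | hy
  · have := le_lastRow hsort.1 hy
    rw [SubQueue.headRow] at hrow
    omega
  · rw [drop_of_getElem? hx] at hy hsort
    rcases List.mem_cons.1 hy with rfl | hy
    · omega
    · have := List.rel_of_pairwise_cons hsort.2.1 hy
      omega

end MemInv

theorem subGrows_link {q : SubQueue α} {x : Node α} (hr : q.removed ≤ q.nodes.length)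
    (hx : q.tailRow ≤ x.row) : SubGrows q (q.link x) where
  length_le := by simp [SubQueue.link]
  tailRow_le := by rwa [SubQueue.link, SubQueue.tailRow, SubQueue.tailRow, lastRow_concat]
  tailRow_eq h := by simp [SubQueue.link] at h
  removed_le := le_rfl
  headRow_le := by simp [SubQueue.headRow, SubQueue.link, List.take_append_of_le_length hr]
  headRow_eq _ := by simp [SubQueue.headRow, SubQueue.link, List.take_append_of_le_length hr]

theorem headRow_unlink {q : SubQueue α} {x : Node α} (hx : q.nodes[q.removed]? = some x) :
    q.unlink.headRow = x.row := by
  simp only [SubQueue.headRow, SubQueue.unlink]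
  rw [take_succ_of_getElem? hx, lastRow_concat]

theorem subGrows_unlink {q : SubQueue α} {x : Node α} (hx : q.nodes[q.removed]? = some x)
    (hlt : q.headRow ≤ x.row) : SubGrows q q.unlink where
  length_le := le_rfl
  tailRow_le := le_rfl
  tailRow_eq _ := rfl
  removed_le := Nat.le_succ _
  headRow_le := by rwa [headRow_unlink hx]
  headRow_eq h := by simp [SubQueue.unlink] at h

end Memory

/-! ### Changes of the shared memory -/

section Changes

variable {T α : Type*} {N : ℕ} {wd : ℕ → ℕ} {s s' : State T N α}

theorem MemInv.congr (hs : MemInv wd s) (htail : s'.tail = s.tail) (hhead : s'.head = s.head)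
    (hlat : s'.lat = s.lat) (hlatHead : s'.latHead = s.latHead) (hsub : s'.sub = s.sub)
    (hdepth : 1 ≤ s'.depthShared) : MemInv wd s' := by
  obtain ⟨tail, head, lat, latHead, sub, d, w, loc, hist⟩ := s
  obtain ⟨tail', head', lat', latHead', sub', d', w', loc', hist'⟩ := s'
  dsimp only at htail hhead hlat hlatHead hsub hdepth
  subst htail hhead hlat hlatHead hsub
  cases hs
  constructor <;> assumption

theorem Grows.of_eq (htail : s'.tail = s.tail) (hhead : s'.head = s.head)
    (hlat : s'.lat = s.lat) (hsub : s'.sub = s.sub) : Grows wd wd s s' where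
  tail := .inl htail
  head := .inl hhead
  lat := .inl hlat
  sub _ := hsub ▸ SubGrows.refl _
  wd_eq _ _ := rfl

theorem Grows.congr {wd' : ℕ → ℕ} {s'' : State T N α} (g : Grows wd wd' s s')
    (htail : s''.tail = s'.tail) (hhead : s''.head = s'.head) (hlat : s''.lat = s'.lat)
    (hsub : s''.sub = s'.sub) : Grows wd wd' s s'' := by
  obtain ⟨g₁, g₂, g₃, g₄, g₅⟩ := g
  refine ⟨?_, ?_, by rwa [hlat], by rwa [hsub], g₅⟩
  · rw [htail]
    simpa only [TailFull, Synced, hsub, hlat] using g₁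
  · rw [hhead]
    simpa only [HeadFull, hsub] using g₂

theorem forall_setSub {i : Fin N} {q : SubQueue α} {P : Fin N → SubQueue α → Prop}
    (h : ∀ j, P j (s.sub j)) (hi : P i q) (j : Fin N) : P j ((s.setSub i q).sub j) := by
  by_cases hj : j = i
  · subst hj
    simpa [State.setSub] using hi
  · simpa [State.setSub, Function.update_of_ne hj] using h j

theorem setSub_self (s : State T N α) (i : Fin N) (q : SubQueue α) :
    (s.setSub i q).sub i = q := by simp [State.setSub]

theorem Grows.setSub {i : Fin N} {q : SubQueue α} (h : SubGrows (s.sub i) q) :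
    Grows wd wd s (s.setSub i q) where
  tail := .inl rfl
  head := .inl rfl
  lat := .inl rfl
  sub := forall_setSub (P := fun j q => SubGrows (s.sub j) q) (fun _ => .refl _) h
  wd_eq _ _ := rfl

/-! ### Each write preserves the memory invariant -/

namespace MemInv

/-- The new row is the lowest one that lies in the tail window and above all nodes of the sub-queue,
so nothing is skipped that `sub_full` requires. -/
theorem link (hs : MemInv wd s) {i : Fin N} (hi : i.val < s.tail.width)
    (hrow : (s.sub i).tailRow < s.tail.max) (v : α) (p : OpId) :
    MemInv wd (s.setSub i ((s.sub i).link
      ⟨v, max (s.tail.max - s.tail.depth) (s.sub i).tailRow + 1, p⟩)) := by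
  have htp := hs.tail_pos
  have htl := hs.tail_le
  have hhp := hs.head_pos
  have hhl := hs.head_le
  have hle := hs.head_le_tail
  set R := max (s.tail.max - s.tail.depth) (s.sub i).tailRow + 1 with hR
  have hR₁ : s.tail.max - s.tail.depth < R := by omega
  have hR₂ : R ≤ s.tail.max := by omega
  have hR₃ : (s.sub i).tailRow < R := by omega
  have hwd : wd R = s.tail.width := hs.wd_tail R hR₁ hR₂
  have hgrow := subGrows_link (x := ⟨v, R, p⟩) (hs.removed_le i) hR₃.le
  refine { hs with
        sub_sorted := ?_
        removed_le := ?_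
        row_le := ?_
        lt_wd := ?_
        sub_full := ?_
        head_full := ?_
        head_lt := ?_ }
  · refine forall_setSub (P := fun _ q => q.nodes.Pairwise fun a b => a.row < b.row)
      hs.sub_sorted ?_
    refine List.pairwise_append.2 ⟨hs.sub_sorted i, by simp, fun a ha b hb => ?_⟩
    rw [List.mem_singleton.1 hb]
    exact (le_lastRow (hs.sub_sorted i) ha).trans_lt hR₃
  · refine forall_setSub (P := fun _ q => q.removed ≤ q.nodes.length) hs.removed_le ?_
    exact (hs.removed_le i).trans hgrow.length_le
  · refine forall_setSub (P := fun _ q => ∀ x ∈ q.nodes, x.row ≤ s.tail.max) hs.row_le ?_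
    intro x hx
    rcases List.mem_append.1 hx with hx | hx
    · exact hs.row_le i x hx
    · rw [List.mem_singleton.1 hx]
      exact hR₂
  · refine forall_setSub (P := fun j q => ∀ x ∈ q.nodes, j.val < wd x.row) hs.lt_wd ?_
    intro x hx
    rcases List.mem_append.1 hx with hx | hx
    · exact hs.lt_wd i x hx
    · rw [List.mem_singleton.1 hx]
      exact hwd ▸ hi
  · refine forall_setSub (P := fun j q => ∀ r : ℕ, 1 ≤ r →
      r ≤ q.tailRow ∨ r ≤ s.tail.max - s.tail.depth → j.val < wd r → ∃ x ∈ q.nodes, x.row = r)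
      hs.sub_full ?_
    intro r hr₁ hr hw
    by_cases hrR : r = R
    · exact ⟨⟨v, R, p⟩, List.mem_append_right _ (by simp), hrR.symm⟩
    · have hlink : ((s.sub i).link ⟨v, R, p⟩).tailRow = R := lastRow_concat _ _
      rw [hlink] at hr
      obtain ⟨x, hx, hxr⟩ := hs.sub_full i r hr₁ (by omega) hw
      exact ⟨x, List.mem_append_left _ hx, hxr⟩
  · refine forall_setSub (P := fun j q => j.val < wd (s.head.max - s.head.depth) →
      s.head.max - s.head.depth ≤ q.headRow) hs.head_full ?_
    exact fun h => (hs.head_full i h).trans hgrow.headRow_le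
  · refine forall_setSub (P := fun _ q => ∀ x ∈ q.nodes.drop q.removed,
      s.head.max - s.head.depth < x.row) hs.head_lt ?_
    intro x hx
    simp only [SubQueue.link] at hx
    rw [List.drop_append_of_le_length (hs.removed_le i)] at hx
    rcases List.mem_append.1 hx with hx | hx
    · exact hs.head_lt i x hx
    · rw [List.mem_singleton.1 hx]
      change s.head.max - s.head.depth < R
      -- Otherwise the head min would be a row of the tail window, hence of width `s.tail.width`.
      -- Then `head_full` forces this sub-queue to be dequeued up to the head min, beyond its own
      -- tail row.
      by_contra! hlt
      have hmin : wd (s.head.max - s.head.depth) = s.tail.width :=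
        hs.wd_tail _ (by omega) (by omega)
      have h₁ := hs.head_full i (hmin ▸ hi)
      have h₂ : (s.sub i).headRow ≤ (s.sub i).tailRow := by
        rw [SubQueue.headRow]
        -- The strict bound is applied to the successor, which is positive even when the tail row is
        -- `0`.
        refine Nat.lt_succ_iff.1 (lastRow_lt (Nat.succ_pos _) fun y hy => Nat.lt_succ_iff.2 ?_)
        exact le_lastRow (hs.sub_sorted i) (List.mem_of_mem_take hy)
      omega

theorem unlink (hs : MemInv wd s) {i : Fin N} {x : Node α}
    (hx : (s.sub i).nodes[(s.sub i).removed]? = some x) :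
    SubGrows (s.sub i) (s.sub i).unlink ∧ MemInv wd (s.setSub i (s.sub i).unlink) := by
  have hmem : x ∈ (s.sub i).nodes.drop (s.sub i).removed := by
    rw [drop_of_getElem? hx]
    simp
  have hgrow := subGrows_unlink hx (hs.headRow_lt hmem).le
  refine ⟨hgrow, { hs with
        sub_sorted := ?_
        removed_le := ?_
        row_le := ?_
        lt_wd := ?_
        sub_full := ?_
        head_full := ?_
        head_lt := ?_ }⟩
  · exact forall_setSub (q := (s.sub i).unlink)
      (P := fun _ q => q.nodes.Pairwise fun a b => a.row < b.row) hs.sub_sorted (hs.sub_sorted i)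
  · exact forall_setSub (P := fun _ q => q.removed ≤ q.nodes.length) hs.removed_le
      (List.getElem?_eq_some_iff.1 hx).1
  · exact forall_setSub (P := fun _ q => ∀ x ∈ q.nodes, x.row ≤ s.tail.max) hs.row_le
      (hs.row_le i)
  · exact forall_setSub (P := fun j q => ∀ x ∈ q.nodes, j.val < wd x.row) hs.lt_wd (hs.lt_wd i)
  · exact forall_setSub (P := fun j q => ∀ r : ℕ, 1 ≤ r →
      r ≤ q.tailRow ∨ r ≤ s.tail.max - s.tail.depth → j.val < wd r → ∃ x ∈ q.nodes, x.row = r)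
      hs.sub_full (hs.sub_full i)
  · exact forall_setSub (P := fun j q => j.val < wd (s.head.max - s.head.depth) →
      s.head.max - s.head.depth ≤ q.headRow) hs.head_full
      fun h => (hs.head_full i h).trans hgrow.headRow_le
  · refine forall_setSub (P := fun _ q => ∀ x ∈ q.nodes.drop q.removed,
      s.head.max - s.head.depth < x.row) hs.head_lt fun y hy => hs.head_lt i y ?_
    rw [drop_of_getElem? hx]
    exact List.mem_cons_of_mem _ hy

/-- The new node lies just above the tail window, where `wd` is not yet constrained; the hypothesis
on rows keeps the Lateral sorted and free of duplicates. -/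
theorem tailLink (hs : MemInv wd s) (hlat : ∀ l ∈ s.lat, l.row ≤ s.tail.max) :
    MemInv wd { s with lat := s.lat ++ [⟨s.tail.max + 1, s.tail.nextWidth⟩] } := by
  have hlt := hs.latHead_lt
  refine { hs with
        lat_sorted := ?_
        lat_le := ?_
        lat_next := ?_
        lat_wd := ?_
        wd_succ := ?_
        latHead_lt := ?_
        latHead_row := ?_ }
  · refine List.pairwise_append.2 ⟨hs.lat_sorted, by simp, fun a ha b hb => ?_⟩
    rw [List.mem_singleton.1 hb]
    exact Nat.lt_succ_of_le (hlat a ha)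
  · intro l hl
    rcases List.mem_append.1 hl with hl | hl
    · exact hs.lat_le l hl
    · rw [List.mem_singleton.1 hl]
  · intro l hl hrow
    rcases List.mem_append.1 hl with hl | hl
    · exact hs.lat_next l hl hrow
    · rw [List.mem_singleton.1 hl]
  · intro l hl hrow
    rcases List.mem_append.1 hl with hl | hl
    · exact hs.lat_wd l hl hrow
    · rw [List.mem_singleton.1 hl] at hrow
      dsimp only at hrow
      omega
  · exact fun r hr h => hs.wd_succ r hr fun l hl => h l (List.mem_append_left _ hl)
  · simp
    omega
  · intro j l hj hle
    dsimp only at hj hle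
    rw [List.getElem?_append_left (by omega)] at hj
    exact hs.latHead_row j l hj hle

theorem headPop (hs : MemInv wd s) {l : LateralNode} (hl : s.lat[s.latHead + 1]? = some l)
    (hrow : l.row ≤ s.head.max) : MemInv wd { s with latHead := s.latHead + 1 } :=
  { hs with
    latHead_lt := (List.getElem?_eq_some_iff.1 hl).1
    latHead_row := fun j l' hj hle => by
      dsimp only at hj hle
      rcases Nat.le_succ_iff.1 hle with hle | rfl
      · exact hs.latHead_row j l' hj hle
      · obtain rfl := Option.some.inj (hl.symm.trans hj)
        exact hrow }

/-- This is the only change of `wd`: rows above the old max get the new width. Fullness of the old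
window leaves no gaps below the new one, and being synced marks the change of width, if any. -/
theorem tailCas (hs : MemInv wd s) {W : TailWindow} (hfull : TailFull s s.tail)
    (hsync : Synced s s.tail) (hd : 1 ≤ W.depth) (hmax : W.max = s.tail.max + W.depth)
    (hwidth : W.width = s.tail.nextWidth) :
    ∃ wd', MemInv wd' { s with tail := W } ∧ Grows wd wd' s { s with tail := W } := by
  have htp := hs.tail_pos
  have hle := hs.head_le_tail
  have hold : ∀ r ≤ s.tail.max, (if r ≤ s.tail.max then wd r else W.width) = wd r :=
    fun r hr => if_pos hr
  have hnew : ∀ r, s.tail.max < r → (if r ≤ s.tail.max then wd r else W.width) = W.width :=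
    fun r hr => if_neg hr.not_ge
  refine ⟨fun r => if r ≤ s.tail.max then wd r else W.width,
    { hs with
        tail_pos := hd
        tail_le := by dsimp only; omega
        head_le_tail := by dsimp only; omega
        wd_tail := ?_
        wd_head := ?_
        lat_le := ?_
        lat_next := ?_
        lat_wd := ?_
        wd_succ := ?_
        row_le := ?_
        lt_wd := ?_
        sub_full := ?_
        head_full := ?_ },
    { tail := .inr ⟨by dsimp only; omega, hfull, hsync⟩, head := .inl rfl, lat := .inl rfl,
      sub := fun _ => .refl _, wd_eq := hold }⟩
  · intro r hr _
    exact hnew r (by dsimp only at hr; omega)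
  · intro r hr hr'
    dsimp only at hr hr' ⊢
    rw [hold r (by omega)]
    exact hs.wd_head r hr hr'
  · intro l hl
    have := hs.lat_le l hl
    dsimp only
    omega
  · intro l hl hrow
    have := hs.lat_le l hl
    dsimp only at hrow
    omega
  · intro l hl hrow
    rcases Nat.le_succ_iff.1 (hs.lat_le l hl) with h | h
    · rw [hold _ h]
      exact hs.lat_wd l hl h
    · rw [hnew _ (by omega), hwidth]
      exact (hs.lat_next l hl h).symm
  · intro r hr hl
    dsimp only at hr hl ⊢
    rcases lt_trichotomy r s.tail.max with h | h | h
    · rw [hold r h.le, hold (r + 1) h]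
      exact hs.wd_succ r h hl
    -- At the seam between the windows, a missing Lateral node means that the width does not change.
    · rw [hold r h.le, hnew _ (by omega), hwidth, h,
        hs.wd_tail s.tail.max (by have := hs.tail_le; omega) le_rfl]
      by_contra hne
      obtain ⟨l, hl', hrow⟩ := hsync (Ne.symm hne)
      exact hl l hl' (by omega)
    · rw [hnew r h, hnew _ (by omega)]
  · intro i x hx
    have := hs.row_le i x hx
    dsimp only
    omega
  · intro i x hx
    rw [hold _ (hs.row_le i x hx)]
    exact hs.lt_wd i x hx
  · intro i r hr₁ hr hw
    have htr : (s.sub i).tailRow ≤ s.tail.max := by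
      refine Nat.lt_succ_iff.1 (lastRow_lt (Nat.succ_pos _) fun y hy => Nat.lt_succ_iff.2 ?_)
      exact hs.row_le i y hy
    dsimp only at hr hw
    have hrm : r ≤ s.tail.max := by omega
    rw [hold r hrm] at hw
    refine hs.sub_full i r hr₁ ?_ hw
    by_cases hmin : r ≤ s.tail.max - s.tail.depth
    · exact .inr hmin
    · rw [hs.wd_tail r (by omega) hrm] at hw
      exact .inl (hrm.trans (hfull i hw))
  · intro i hi
    dsimp only at hi ⊢
    rw [hold _ (by omega)] at hi
    exact hs.head_full i hi

/-- The new min is the old max, so exhaustion of the old window is what `head_full` and `head_lt`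
demand of the new one. -/
theorem headCas (hs : MemInv wd s) {W : HeadWindow} (hfull : HeadFull s s.head)
    (hlt : s.head.max < W.max) (hle : W.max ≤ s.tail.max) (hd : W.depth = W.max - s.head.max)
    (hwd : ∀ r, s.head.max < r → r ≤ W.max → wd r = W.width) :
    MemInv wd { s with head := W } ∧ Grows wd wd s { s with head := W } := by
  have hhp := hs.head_pos
  have hhl := hs.head_le
  have hmin : W.max - W.depth = s.head.max := by omega
  have hmax := hs.wd_head s.head.max (by omega) le_rfl
  refine ⟨{ hs with
        head_pos := by dsimp only; omega
        head_le := by dsimp only; omega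
        head_le_tail := hle
        wd_head := ?_
        latHead_row := ?_
        head_full := ?_
        head_lt := ?_ },
    { tail := .inl rfl, head := .inr ⟨hlt, hfull⟩, lat := .inl rfl,
      sub := fun _ => .refl _, wd_eq := fun _ _ => rfl }⟩
  · intro r hr hr'
    dsimp only at hr
    rw [hmin] at hr
    exact hwd r hr hr'
  · exact fun j l hj hle => (hs.latHead_row j l hj hle).trans hlt.le
  · intro i hi
    dsimp only at hi ⊢
    rw [hmin, hmax] at hi
    rw [hmin]
    exact hfull i hi
  · intro i x hx
    dsimp only
    rw [hmin]
    -- An item left behind would lie in the old head window, in a sub-queue already dequeued past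
    -- its row.
    by_contra! hle'
    have h₁ := hs.headRow_lt hx
    have h₂ := hs.lt_wd i x (List.mem_of_mem_drop hx)
    rw [hs.wd_head x.row (hs.head_lt i x hx) hle'] at h₂
    have := hfull i h₂
    omega

end MemInv

end Changes

/-! ### The items in the queue -/

/-- An item in the queue: its sub-queue, its node, and the tail window in which it was enqueued. -/
structure QueueItem (N : ℕ) (α : Type*) where
  idx : Fin N
  node : Node α
  win : TailWindow

section Queue

variable {T α : Type*} {N : ℕ} {wd wd' : ℕ → ℕ} {s s' : State T N α}

/-- Invariants of an item in the queue. -/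
structure ItemInv (wd : ℕ → ℕ) (s : State T N α) (q : QueueItem N α) : Prop where
  win_le : q.win.max ≤ s.tail.max
  lt_row : q.win.max - q.win.depth < q.node.row
  row_le : q.node.row ≤ q.win.max
  wd_win : ∀ r, q.win.max - q.win.depth < r → r ≤ q.win.max → wd r = q.win.width
  inserted : Event.inserted q.node.op q.win ∈ s.hist
  invokes : Invokes s.hist q.node.op (.enq q.node.val)

/-- The items `Q`, in the order in which they were linked, are the items of the sub-queues. -/
structure QueueInv (wd : ℕ → ℕ) (Q : List (QueueItem N α)) (s : State T N α) : Prop where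
  queue : ∀ i, (Q.filter fun q => q.idx = i).map QueueItem.node =
    (s.sub i).nodes.drop (s.sub i).removed
  sorted : Q.Pairwise fun a b => a.win.max ≤ b.win.max ∧
    (a.idx = b.idx → a.node.row < b.node.row)
  item : ∀ q ∈ Q, ItemInv wd s q

theorem ItemInv.mono {q : QueueItem N α} (h : ItemInv wd s q) (g : Grows wd wd' s s')
    {E : List (Event T α)} (hhist : s'.hist = s.hist ++ E) : ItemInv wd' s' q where
  win_le := h.win_le.trans g.tail_max_le
  lt_row := h.lt_row
  row_le := h.row_le
  wd_win r hr hr' := by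
    rw [g.wd_eq r (hr'.trans h.win_le)]
    exact h.wd_win r hr hr'
  inserted := hhist ▸ List.mem_append_left _ h.inserted
  invokes := hhist ▸ h.invokes.append _

namespace QueueInv

variable {Q : List (QueueItem N α)}

theorem mono (h : QueueInv wd Q s) (g : Grows wd wd' s s') (hsub : s'.sub = s.sub)
    {E : List (Event T α)} (hhist : s'.hist = s.hist ++ E) : QueueInv wd' Q s' where
  queue i := hsub ▸ h.queue i
  sorted := h.sorted
  item q hq := (h.item q hq).mono g hhist

theorem mem_drop (h : QueueInv wd Q s) {q : QueueItem N α} (hq : q ∈ Q) :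
    q.node ∈ (s.sub q.idx).nodes.drop (s.sub q.idx).removed := by
  rw [← h.queue]
  exact List.mem_map_of_mem (List.mem_filter.2 ⟨hq, by simp⟩)

/-- The queue is empty when all sub-queues inside the head window are empty and the head window has
caught up with the tail window. -/
theorem eq_nil (h : QueueInv wd Q s) (hs : MemInv wd s) (hmax : s.head.max = s.tail.max)
    (hempty : ∀ i : Fin N, i.val < s.head.width → (s.sub i).IsEmpty) : Q = [] := by
  refine List.eq_nil_iff_forall_not_mem.2 fun q hq => ?_
  have hmem := h.mem_drop hq
  have hmem' := List.mem_of_mem_drop hmem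
  have h₁ := hs.lt_wd _ _ hmem'
  rw [hs.wd_head _ (hs.head_lt _ _ hmem) (hmax ▸ hs.row_le _ _ hmem')] at h₁
  rw [List.drop_eq_nil_of_le (hempty _ h₁)] at hmem
  simp at hmem

/-- The first item of a sub-queue has no item of this sub-queue in front of it. -/
theorem exists_split (h : QueueInv wd Q s) {i : Fin N} {x : Node α}
    (hx : (s.sub i).nodes[(s.sub i).removed]? = some x) :
    ∃ Q₁ q Q₂, Q = Q₁ ++ q :: Q₂ ∧ q.idx = i ∧ q.node = x ∧ (∀ a ∈ Q₁, a.idx ≠ i) ∧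
      (Q₂.filter fun q => q.idx = i).map QueueItem.node =
        (s.sub i).nodes.drop ((s.sub i).removed + 1) := by
  have hq := h.queue i
  rw [drop_of_getElem? hx] at hq
  obtain ⟨q, ys, hys, hqx, htl⟩ := List.map_eq_cons_iff.1 hq
  obtain ⟨Q₁, Q₂, hQ, h₁, h₂, h₃⟩ := List.filter_eq_cons_iff.1 hys
  exact ⟨Q₁, q, Q₂, hQ, by simpa using h₂, hqx, by simpa using h₁, by rw [h₃, htl]⟩

/-- The number of items in front of an item that is dequeued. -/
theorem length_le (h : QueueInv wd Q s) (hs : MemInv wd s) {Q₁ Q₂ : List (QueueItem N α)}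
    {q : QueueItem N α} (hQ : Q = Q₁ ++ q :: Q₂) (hrow : q.node.row ≤ s.head.max)
    (hne : ∀ a ∈ Q₁, a.idx ≠ q.idx) :
    (Q₁.length : ℤ) ≤
      ((q.win.width : ℤ) - 1) * ((q.win.depth : ℤ) + (s.head.depth : ℤ) - 1) := by
  have hq : q ∈ Q := by simp [hQ]
  have hqmem := h.mem_drop hq
  have hqi := h.item q hq
  have h₁ := hs.head_lt _ _ hqmem
  have h₂ := hqi.lt_row
  have h₃ := hqi.row_le
  have hwidth : s.head.width = q.win.width := by
    rw [← hs.wd_head _ h₁ hrow, hqi.wd_win _ h₂ h₃]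
  -- Both windows contain the row of `q`, so they have one width and their union has no hole.
  have hwd : ∀ r, s.head.max - s.head.depth < r → r ≤ q.win.max → wd r = q.win.width := by
    intro r hr hr'
    by_cases hle : r ≤ s.head.max
    · rw [hs.wd_head r hr hle, hwidth]
    · exact hqi.wd_win r (by omega) hr'
  have hqw : q.idx.val < q.win.width := by
    rw [← hqi.wd_win _ h₂ h₃]
    exact hs.lt_wd _ _ (List.mem_of_mem_drop hqmem)
  have hsort := h.sorted
  rw [hQ, List.pairwise_append] at hsort
  -- Rows strictly increase within a sub-queue, so the cell determines the item.
  have hnodup : (Q₁.map fun a => (a.idx, a.node.row)).Nodup := by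
    rw [List.Nodup, List.pairwise_map]
    refine hsort.1.imp fun {a b} hab heq => ?_
    obtain ⟨h₁, h₂⟩ := Prod.ext_iff.1 heq
    exact (hab.2 h₁).ne h₂
  have hsubset : (Q₁.map fun a => (a.idx, a.node.row)).toFinset ⊆
      ((Finset.univ.filter fun j : Fin N => j.val < q.win.width).erase q.idx) ×ˢ
        Finset.Ioc (s.head.max - s.head.depth) q.win.max := by
    intro y hy
    obtain ⟨a, ha, rfl⟩ := List.mem_map.1 (List.mem_toFinset.1 hy)
    have haQ : a ∈ Q := by simp [hQ, ha]
    have hamem := h.mem_drop haQ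
    have hlt := hs.head_lt _ _ hamem
    have hle : a.node.row ≤ q.win.max :=
      (h.item a haQ).row_le.trans (hsort.2.2 a ha q (by simp)).1
    have := hs.lt_wd _ _ (List.mem_of_mem_drop hamem)
    rw [hwd _ hlt hle] at this
    simp [hne a ha, this, hlt, hle]
  have hcard := Finset.card_le_card hsubset
  rw [List.toFinset_card_of_nodup hnodup, List.length_map, Finset.card_product,
    Nat.card_Ioc, Finset.card_erase_of_mem (by simpa using hqw)] at hcard
  have hfin : (Finset.univ.filter fun j : Fin N => j.val < q.win.width).card ≤ q.win.width := by
    rw [← Finset.card_range q.win.width]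
    exact Finset.card_le_card_of_injOn Fin.val (fun j hj => by simpa using hj)
      Fin.val_injective.injOn
  -- The overlap saves one row: the min of the enqueue window is strictly below the row of `q`,
  -- which is at most the head max.
  have hle : Q₁.length ≤ (q.win.width - 1) * (q.win.depth + s.head.depth - 1) :=
    hcard.trans (Nat.mul_le_mul (by omega) (by omega))
  have hpos := hs.head_pos
  calc (Q₁.length : ℤ) ≤ ((q.win.width - 1) * (q.win.depth + s.head.depth - 1) : ℕ) :=
        Int.ofNat_le.2 hle
    _ = _ := by
      rw [Nat.cast_mul, Nat.cast_sub (by omega), Nat.cast_sub (by omega)]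
      push_cast
      ring

theorem link (h : QueueInv wd Q s) (hs : MemInv wd s) {i : Fin N} {x : Node α}
    (htail : (s.sub i).tailRow < x.row)
    (hmin : s.tail.max - s.tail.depth < x.row) (hmax : x.row ≤ s.tail.max)
    (g : Grows wd wd s s') (hsub : s'.sub = (s.setSub i ((s.sub i).link x)).sub)
    (hhist : s'.hist = s.hist ++ [.inserted x.op s.tail])
    (hinv : Invokes s.hist x.op (.enq x.val)) : QueueInv wd (Q ++ [⟨i, x, s.tail⟩]) s' where
  queue j := by
    rw [hsub, List.filter_append, List.map_append, h.queue j]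
    by_cases hj : j = i
    · subst hj
      rw [setSub_self, SubQueue.link, List.drop_append_of_le_length (hs.removed_le j)]
      simp
    · simp [State.setSub, Function.update_of_ne hj, Ne.symm hj]
  sorted := by
    refine List.pairwise_append.2 ⟨h.sorted, by simp, fun a ha b hb => ?_⟩
    rw [List.mem_singleton.1 hb]
    refine ⟨(h.item a ha).win_le, fun heq => ?_⟩
    obtain rfl : a.idx = i := heq
    exact (le_lastRow (hs.sub_sorted _) (List.mem_of_mem_drop (h.mem_drop ha))).trans_lt htail
  item q hq := by
    rcases List.mem_append.1 hq with hq | hq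
    · exact (h.item q hq).mono g hhist
    · rw [List.mem_singleton.1 hq]
      exact { win_le := g.tail_max_le, lt_row := hmin, row_le := hmax, wd_win := hs.wd_tail
              inserted := by simp [hhist], invokes := hhist ▸ hinv.append _ }

theorem unlink (h : QueueInv wd Q s) {i : Fin N} {Q₁ Q₂ : List (QueueItem N α)}
    {q : QueueItem N α} (hQ : Q = Q₁ ++ q :: Q₂) (hq : q.idx = i) (hne : ∀ a ∈ Q₁, a.idx ≠ i)
    (hQ₂ : (Q₂.filter fun q => q.idx = i).map QueueItem.node =
        (s.sub i).nodes.drop ((s.sub i).removed + 1))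
    (g : Grows wd wd s s') (hsub : s'.sub = (s.setSub i (s.sub i).unlink).sub)
    {E : List (Event T α)} (hhist : s'.hist = s.hist ++ E) : QueueInv wd (Q₁ ++ Q₂) s' where
  queue j := by
    rw [hsub]
    by_cases hj : j = i
    · subst hj
      have : Q₁.filter (fun q => q.idx = j) = [] := by simpa using hne
      rw [setSub_self, List.filter_append, this, List.nil_append, hQ₂]
      rfl
    · have := h.queue j
      rw [hQ, List.filter_append, List.filter_cons_of_neg (by simpa [hq] using Ne.symm hj)] at this
      simpa [State.setSub, Function.update_of_ne hj, List.filter_append] using this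
  sorted := h.sorted.sublist (hQ ▸ (List.sublist_cons_self _ _).append_left _)
  item a ha := (h.item a (by
    rw [hQ]
    rcases List.mem_append.1 ha with ha | ha <;> simp [ha])).mono g hhist

end QueueInv

end Queue

/-! ### Pending operations -/

section Operations

variable {T α : Type*} {N : ℕ}

/-- `p` is a pending operation of thread `t` that invoked `o`. -/
def Pending (H : List (Event T α)) (t : T) (p : OpId) (o : Op α) : Prop :=
  H[p]? = some (.inv t o) ∧ ∀ r, Event.ret p r ∉ H

/-- `p` is a pending operation that has not been linearized. -/
def Unlinearized (H : List (Event T α)) (L : List (OpId × Ret α)) (t : T) (p : OpId) (o : Op α) :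
    Prop :=
  Pending H t p o ∧ ∀ r, (p, r) ∉ L

/-- The second collect `again` is bound to fail, or the head window has fallen behind. -/
def RecollectFails (s : State T N α) (W : HeadWindow) (c : Fin N → Option ℕ)
    (again : Set (Fin N)) : Prop :=
  W.max < s.tail.max ∨ ∃ i : Fin N, i.val < W.width ∧ i ∉ again ∧
    ∀ k, c i = some k → k < (s.sub i).nodes.length

/-- How the local state of thread `t` is related to the linearization `L`. -/
def OpInv (L : List (OpId × Ret α)) (s : State T N α) (t : T) : Local N α → Prop
  | .idle => True
  | .done p r => (∃ o, Pending s.hist t p o) ∧ (p, r) ∈ L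
  | .recollect p W c again => Pending s.hist t p .deq ∧
      ((p, .empty) ∈ L ∨ (∀ r, (p, r) ∉ L) ∧ RecollectFails s W c again)
  | .enqStart p v | .enqSearch p v _ _ | .enqTry p v _ _ _ _ | .tailSync p v _ | .tailLink p v _ _
  | .tailDepth p v _ | .tailWidth p v _ _ | .tailCas p v _ _ =>
    Unlinearized s.hist L t p (.enq v)
  | .deqStart p | .deqSearch p _ _ | .deqTry p _ _ _ _ | .collect p _ _ | .headClean p _
  | .headPop p _ _ | .headTail p _ _ | .headDepth p _ _ _ | .headWidth p _ _ _
  | .headLimit p _ _ _ _ | .headCas p _ _ => Unlinearized s.hist L t p .deq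

/-- The changes of the history and the linearization concern no operation of thread `t`. -/
def Unaffected (H H' : List (Event T α)) (L L' : List (OpId × Ret α)) (t : T) : Prop :=
  ∀ p o, H[p]? = some (.inv t o) → H'[p]? = some (.inv t o) ∧
    ∀ r, (Event.ret p r ∈ H' → Event.ret p r ∈ H) ∧ ((p, r) ∈ L' ↔ (p, r) ∈ L)

namespace Unaffected

variable {H H' : List (Event T α)} {L L' : List (OpId × Ret α)} {t : T}

theorem refl : Unaffected H H L L t := fun _ _ h => ⟨h, fun _ => ⟨id, Iff.rfl⟩⟩

theorem log {e : Event T α} (he : ∀ p o r, H[p]? = some (.inv t o) → e ≠ .ret p r)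
    (hL : ∀ p o r, H[p]? = some (.inv t o) → ((p, r) ∈ L' ↔ (p, r) ∈ L)) :
    Unaffected H (H ++ [e]) L L' t := by
  intro p o h
  refine ⟨by rw [List.getElem?_append_left (List.getElem?_eq_some_iff.1 h).1, h],
    fun r => ⟨fun hr => ?_, hL p o r h⟩⟩
  rcases List.mem_append.1 hr with hr | hr
  · exact hr
  · exact absurd (List.mem_singleton.1 hr).symm (he p o r h)

theorem pending (hu : Unaffected H H' L L' t) {p : OpId} {o : Op α} (h : Pending H t p o) :
    Pending H' t p o :=
  ⟨(hu p o h.1).1, fun r hr => h.2 r (((hu p o h.1).2 r).1 hr)⟩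

theorem unlinearized (hu : Unaffected H H' L L' t) {p : OpId} {o : Op α}
    (h : Unlinearized H L t p o) : Unlinearized H' L' t p o :=
  ⟨hu.pending h.1, fun r hr => h.2 r (((hu p o h.1.1).2 r).2.1 hr)⟩

end Unaffected

theorem Pending.ne {H : List (Event T α)} {t t' : T} {p q : OpId} {o o' : Op α}
    (hp : Pending H t p o) (ht : t' ≠ t) (hq : H[q]? = some (.inv t' o')) : q ≠ p := by
  rintro rfl
  rw [hp.1] at hq
  simp only [Option.some.injEq, Event.inv.injEq] at hq
  exact ht hq.1.symm

theorem mem_concat_iff {L : List (OpId × Ret α)} {p q : OpId} (hne : q ≠ p) {r r' : Ret α} :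
    (q, r') ∈ L ++ [(p, r)] ↔ (q, r') ∈ L := by simp [hne]

/-- Both reasons for failure are strict lower bounds on quantities that never decrease. -/
theorem RecollectFails.mono {wd wd' : ℕ → ℕ} {s s' : State T N α} {W : HeadWindow}
    {c : Fin N → Option ℕ} {again : Set (Fin N)} (h : RecollectFails s W c again)
    (g : Grows wd wd' s s') : RecollectFails s' W c again := by
  rcases h with h | ⟨i, h₁, h₂, h₃⟩
  · exact .inl (h.trans_le g.tail_max_le)
  · exact .inr ⟨i, h₁, h₂, fun k hk => (h₃ k hk).trans_le (g.sub i).length_le⟩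

theorem OpInv.mono {wd wd' : ℕ → ℕ} {s s' : State T N α} {L L' : List (OpId × Ret α)} {t : T}
    {l : Local N α} (h : OpInv L s t l) (g : Grows wd wd' s s')
    (hu : Unaffected s.hist s'.hist L L' t) : OpInv L' s' t l := by
  cases l with
  | idle => trivial
  | done p r =>
    obtain ⟨⟨o, hp⟩, hL⟩ := h
    exact ⟨⟨o, hu.pending hp⟩, ((hu p o hp.1).2 r).2.2 hL⟩
  | recollect p W c again =>
    obtain ⟨hp, h⟩ := h
    refine ⟨hu.pending hp, ?_⟩
    rcases h with h | ⟨h₁, h₂⟩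
    · exact .inl (((hu p _ hp.1).2 _).2.2 h)
    · exact .inr ⟨fun r hr => h₁ r (((hu p _ hp.1).2 r).2.1 hr), h₂.mono g⟩
  | _ => exact hu.unlinearized h

/-- The invariant of the elastic queue: `wd` gives the widths of the rows, `L` is a linearization of
the history so far, and `Q` are the items in the queue. -/
structure Inv (wd : ℕ → ℕ) (L : List (OpId × Ret α)) (Q : List (QueueItem N α))
    (s : State T N α) : Prop where
  mem : MemInv wd s
  loc : ∀ t, LocInv wd s (s.loc t)
  lin : LinearizedBy s.hist L (Q.map fun q => q.node.op)
  queue : QueueInv wd Q s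
  op : ∀ t, OpInv L s t (s.loc t)

namespace Inv

variable {wd wd' : ℕ → ℕ} {L L' : List (OpId × Ret α)}
  {Q Q' : List (QueueItem N α)} {s s' : State T N α}

theorem configure (h : Inv wd L Q s) {d w : ℕ} (hd : 1 ≤ d) :
    Inv wd L Q { s with depthShared := d, widthShared := w } :=
  have g : Grows wd wd s { s with depthShared := d, widthShared := w } := .of_eq rfl rfl rfl rfl
  { mem := h.mem.congr rfl rfl rfl rfl rfl hd
    loc := fun t => g.locInv h.mem (h.loc t)
    lin := h.lin
    queue := h.queue.mono g rfl (E := []) (List.append_nil _).symm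
    op := fun t => (h.op t).mono g .refl }

theorem initial {d w : ℕ} (hd : 1 ≤ d) :
    Inv (fun _ => w) [] [] (initial T N α d w) where
  mem := by
    constructor <;> simp_all [ElasticQueue.initial, SubQueue.tailRow, lastRow]
    · rintro _ l hl rfl
      simp only [List.getElem?_cons_zero, Option.some.injEq] at hl
      simp [← hl]
    · intros
      omega
  loc t := trivial
  lin := .nil
  queue := ⟨fun i => rfl, .nil, by simp⟩
  op t := trivial

variable [DecidableEq T]

/-- A transition of thread `t` to the local state `l`. -/
theorem update (h : Inv wd L Q s) {t : T} {l : Local N α}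
    (hloc : s'.loc = Function.update s.loc t l) (hmem : MemInv wd' s') (g : Grows wd wd' s s')
    (hl : LocInv wd' s' l) (hlin : LinearizedBy s'.hist L' (Q'.map fun q => q.node.op))
    (hqueue : QueueInv wd' Q' s') (hu : ∀ t' ≠ t, Unaffected s.hist s'.hist L L' t')
    (hop : OpInv L' s' t l) : Inv wd' L' Q' s' where
  mem := hmem
  loc t' := by
    by_cases ht : t' = t
    · subst ht
      simpa [hloc] using hl
    · rw [hloc, Function.update_of_ne ht]
      exact g.locInv h.mem (h.loc t')
  lin := hlin
  queue := hqueue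
  op t' := by
    by_cases ht : t' = t
    · subst ht
      simpa [hloc] using hop
    · rw [hloc, Function.update_of_ne ht]
      exact (h.op t').mono g (hu t' ht)

/-- A transition that changes neither the history nor the sub-queues. -/
theorem memory (h : Inv wd L Q s) {t : T} {l : Local N α}
    (hloc : s'.loc = Function.update s.loc t l) (hmem : MemInv wd' s') (g : Grows wd wd' s s')
    (hsub : s'.sub = s.sub) (hhist : s'.hist = s.hist) (hl : LocInv wd' s' l)
    (hop : OpInv L s t l) : Inv wd' L Q s' :=
  have hu : ∀ t', Unaffected s.hist s'.hist L L t' := fun _ => hhist ▸ .refl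
  h.update hloc hmem g hl (hhist ▸ h.lin)
    (h.queue.mono g hsub (E := []) (by rw [hhist, List.append_nil])) (fun t' _ => hu t')
    (hop.mono g (hu t))

/-- A transition that changes only the local state of thread `t`. -/
theorem goto (h : Inv wd L Q s) {t : T} {l : Local N α} (hl : LocInv wd s l)
    (hop : OpInv L s t l) : Inv wd L Q (s.goto t l) :=
  have g : Grows wd wd s (s.goto t l) := .of_eq rfl rfl rfl rfl
  h.memory rfl (h.mem.congr rfl rfl rfl rfl rfl h.mem.depthShared_pos) g rfl rfl
    (g.locInv h.mem hl) hop

theorem invoke (h : Inv wd L Q s) {t : T} {o : Op α} {l : Local N α} (hl : LocInv wd s l)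
    (hop : ∀ s', Unlinearized s'.hist L t s.hist.length o → OpInv L s' t l) :
    Inv wd L Q ((s.goto t l).log (.inv t o)) := by
  have g : Grows wd wd s ((s.goto t l).log (.inv t o)) := .of_eq rfl rfl rfl rfl
  refine h.update rfl (h.mem.congr rfl rfl rfl rfl rfl h.mem.depthShared_pos) g
    (g.locInv h.mem hl) (h.lin.log _ (by simp)) (h.queue.mono g rfl rfl)
    (fun t' _ => .log (by simp) (by simp)) (hop _ ⟨⟨by simp [State.log, State.goto], ?_⟩, ?_⟩)
  · intro r hr
    have hr : Event.ret s.hist.length r ∈ s.hist := by simpa [State.log, State.goto] using hr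
    exact (h.lin.lt_length (h.lin.ret _ _ hr)).false
  · exact fun r hr => (h.lin.lt_length hr).false

theorem respond (h : Inv wd L Q s) {t : T} {p : OpId} {r : Ret α} (ht : s.loc t = .done p r) :
    Inv wd L Q ((s.goto t .idle).log (.ret p r)) := by
  have g : Grows wd wd s ((s.goto t .idle).log (.ret p r)) := .of_eq rfl rfl rfl rfl
  have hop := h.op t
  rw [ht] at hop
  obtain ⟨⟨o, hp⟩, hL⟩ := hop
  refine h.update rfl (h.mem.congr rfl rfl rfl rfl rfl h.mem.depthShared_pos) g
    trivial (h.lin.log _ fun q r' he => ?_) (h.queue.mono g rfl rfl)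
    (fun t' ht' => .log (fun q o' r' hq he => ?_) (by simp)) trivial
  · cases he
    exact hL
  · cases he
    exact hp.ne ht' hq rfl

theorem enqSucceed (h : Inv wd L Q s) {t : T} {p : OpId} {v : α} {W : TailWindow}
    {full : Set (Fin N)} {i : Fin N} {n : ℕ} (ht : s.loc t = .enqTry p v W full i n)
    (hn : (s.sub i).nodes.length = n) :
    ∃ L' Q', Inv wd L' Q' (((s.goto t (.done p .ack)).setSub i
      ((s.sub i).link ⟨v, max (W.max - W.depth) (s.sub i).tailRow + 1, p⟩)).log
        (.inserted p s.tail)) := by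
  have hop := h.op t
  have hloc := h.loc t
  rw [ht] at hop hloc
  obtain ⟨hp, hL⟩ := hop
  obtain ⟨hW, _, hi, _, hrow⟩ := hloc
  replace hrow := hrow hn
  -- The unchanged length shows that there is still room below `W.max`, so the local copy is the
  -- current window and the computed row is right.
  obtain rfl := hW.eq_tail hi hrow
  have htp := h.mem.tail_pos
  have htl := h.mem.tail_le
  have hmem := h.mem.link hi hrow v p
  have g : Grows wd wd s (((s.goto t (.done p .ack)).setSub i ((s.sub i).link
      ⟨v, max (s.tail.max - s.tail.depth) (s.sub i).tailRow + 1, p⟩)).log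
        (.inserted p s.tail)) := by
    refine (Grows.setSub (subGrows_link (x := ⟨v, max (s.tail.max - s.tail.depth)
      (s.sub i).tailRow + 1, p⟩) (h.mem.removed_le i) ?_)).congr rfl rfl rfl rfl
    dsimp only
    omega
  have hpinv : Invokes s.hist p (.enq v) := ⟨t, hp.1⟩
  refine ⟨L ++ [(p, .ack)],
    Q ++ [⟨i, ⟨v, max (s.tail.max - s.tail.depth) (s.sub i).tailRow + 1, p⟩, s.tail⟩],
    h.update rfl (hmem.congr rfl rfl rfl rfl rfl hmem.depthShared_pos) g trivial ?_
    (h.queue.link h.mem (by dsimp only; omega) (by dsimp only; omega) (by dsimp only; omega)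
      g rfl rfl hpinv)
    (fun t' ht' => .log (by simp) fun q o r hq => mem_concat_iff (hp.ne ht' hq)) ?_⟩
  · rw [List.map_append]
    exact (h.lin.concat (.enq _ _ _ hpinv) hpinv hp.2 hL).log _ (by simp)
  · refine ⟨⟨_, (Unaffected.log (L := L) (L' := L) ?_ ?_).pending hp⟩, by simp⟩ <;> simp

theorem deqSucceed (h : Inv wd L Q s) {t : T} {p : OpId} {W : HeadWindow}
    {full : Set (Fin N)} {i : Fin N} {n : ℕ} {x : Node α} (ht : s.loc t = .deqTry p W full i n)
    (hn : (s.sub i).removed = n) (hx : (s.sub i).nodes[n]? = some x) :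
    ∃ L' Q', Inv wd L' Q' (((s.goto t (.done p (.item x.val))).setSub i (s.sub i).unlink).log
        (.taken p x.op s.head)) := by
  have hop := h.op t
  have hloc := h.loc t
  rw [ht] at hop hloc
  obtain ⟨hp, hL⟩ := hop
  obtain ⟨hW, _, hi, _, hrow⟩ := hloc
  replace hrow := hrow hn
  obtain rfl := hW.eq_head hi hrow
  subst hn
  obtain ⟨hgrow, hmem⟩ := h.mem.unlink hx
  have g : Grows wd wd s (((s.goto t (.done p (.item x.val))).setSub i (s.sub i).unlink).log
      (.taken p x.op s.head)) := (Grows.setSub hgrow).congr rfl rfl rfl rfl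
  have hpinv : Invokes s.hist p .deq := ⟨t, hp.1⟩
  obtain ⟨Q₁, q, Q₂, hQ, rfl, rfl, hne, hQ₂⟩ := h.queue.exists_split hx
  have hlen := h.queue.length_le h.mem hQ (h.mem.row_le_head hi hrow hx) hne
  have hq := h.queue.item q (by simp [hQ])
  have hp' : Pending (s.hist ++ [.taken p q.node.op s.head]) t p .deq :=
    (Unaffected.log (L := L) (L' := L) (by simp) (by simp)).pending hp
  refine ⟨L ++ [(p, .item q.node.val)], Q₁ ++ Q₂,
    h.update rfl (hmem.congr rfl rfl rfl rfl rfl hmem.depthShared_pos) g trivial ?_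
    (h.queue.unlink hQ rfl hne hQ₂ g rfl rfl)
    (fun t' ht' => .log (by simp) fun q o r hq => mem_concat_iff (hp.ne ht' hq))
    ⟨⟨_, hp'⟩, by simp⟩⟩
  -- The mark is logged before the dequeue is appended, since `RankBound` looks for it in the
  -- history.
  refine (h.lin.log (.taken p q.node.op s.head) (by simp)).concat ?_ (hpinv.append _) hp'.2 hL
  rw [hQ, List.map_append, List.map_append, List.map_cons]
  refine .deq _ _ _ _ _ _ (hpinv.append _) (hq.invokes.append _)
    ⟨q.win, s.head, List.mem_append_left _ hq.inserted, by simp, rfl⟩ ?_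
  rwa [List.length_map]

/-- If the collect is not doomed, `W` is the head window and has caught up with the tail window.
Moreover the length of each sub-queue in it is at most the recorded count, hence at most the current
number of removals; so all are empty at this moment. -/
theorem recollectStart (h : Inv wd L Q s) {t : T} {p : OpId} {W : HeadWindow}
    {c : Fin N → Option ℕ} (ht : s.loc t = .collect p W c)
    (hc : Covers {i | c i ≠ none} W.width) :
    ∃ L', Inv wd L' Q (s.goto t (.recollect p W c ∅)) := by
  have hop := h.op t
  have hloc := h.loc t
  rw [ht] at hop hloc
  obtain ⟨hp, hL⟩ := hop
  obtain ⟨hW, hcol⟩ := hloc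
  by_cases hf : RecollectFails s W c ∅
  · exact ⟨L, h.goto trivial ⟨hp, .inr ⟨hL, hf⟩⟩⟩
  have hle := h.mem.head_le_tail
  have hWle := hW.max_le
  have hmax : s.tail.max ≤ W.max := not_lt.1 fun hlt => hf (.inl hlt)
  obtain rfl : W = s.head := by
    rcases hW with hW | hW
    · exact hW
    · omega
  obtain rfl : Q = [] := by
    refine h.queue.eq_nil h.mem (by omega) fun i hi => ?_
    by_contra hne
    refine hf (.inr ⟨i, hi, by simp, fun k hk => ?_⟩)
    exact (hcol i k hk).trans_lt (not_le.1 hne)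
  have hpinv : Invokes s.hist p .deq := ⟨t, hp.1⟩
  have g : Grows wd wd s (s.goto t (.recollect p s.head c ∅)) := .of_eq rfl rfl rfl rfl
  exact ⟨L ++ [(p, .empty)],
    h.update rfl (h.mem.congr rfl rfl rfl rfl rfl h.mem.depthShared_pos) g trivial
      (h.lin.concat (.empty p hpinv) hpinv hp.2 hL)
      (h.queue.mono g rfl (E := []) (List.append_nil _).symm)
      (fun t' ht' q o hq => ⟨hq, fun r => ⟨id, mem_concat_iff (hp.ne ht' hq)⟩⟩)
      ⟨hp, .inl (by simp)⟩⟩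

/-- The dequeue must be unlinearized again before it restarts, so a tentative empty answer is
withdrawn. -/
theorem recollectAbort (h : Inv wd L Q s) {t : T} {p : OpId} {W : HeadWindow}
    {c : Fin N → Option ℕ} {again : Set (Fin N)} (ht : s.loc t = .recollect p W c again) :
    ∃ L', Inv wd L' Q (s.goto t (.deqStart p)) := by
  have hop := h.op t
  rw [ht] at hop
  obtain ⟨hp, hL | ⟨hL, _⟩⟩ := hop
  · have g : Grows wd wd s (s.goto t (.deqStart p)) := .of_eq rfl rfl rfl rfl
    refine ⟨L.filter fun x => x.1 ≠ p,
      h.update rfl (h.mem.congr rfl rfl rfl rfl rfl h.mem.depthShared_pos) g trivial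
      (h.lin.filter hL hp.2) (h.queue.mono g rfl (E := []) (List.append_nil _).symm)
      (fun t' ht' q o hq => ⟨hq, fun r => ⟨id, ?_⟩⟩) ⟨hp, by simp⟩⟩
    simp [hp.ne ht' hq]
  · exact ⟨L, h.goto trivial ⟨hp, hL⟩⟩

end Inv

end Operations

/-! ### The Lateral as seen by ShiftHead, and preservation of the invariant -/

section Invariance

variable {T α : Type*} {N : ℕ}

/-- Nodes up to the dummy never lie above the head max, and sortedness extends the test of the next
node to all later ones. -/
theorem latSplit_of_clean {wd : ℕ → ℕ} {s : State T N α} (hs : MemInv wd s)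
    (hl : ∀ l, s.lat[s.latHead + 1]? = some l → s.head.max < l.row) :
    LatSplit s s.head.max s.latHead := by
  refine ⟨hs.latHead_lt, fun j l hj => ⟨fun hrow => ?_, hs.latHead_row j l hj⟩⟩
  by_contra! hlt
  obtain ⟨hj', rfl⟩ := List.getElem?_eq_some_iff.1 hj
  have h₁ := hl _ (List.getElem?_eq_getElem (by omega))
  rcases Nat.lt_or_ge (s.latHead + 1) j with h | h
  · have := List.pairwise_iff_getElem.1 hs.lat_sorted _ _ (by omega) hj' h
    omega
  · obtain rfl : j = s.latHead + 1 := by omega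
    omega

theorem LatSplit.succ_of_eq {wd : ℕ → ℕ} {s : State T N α} (hs : MemInv wd s) {R n : ℕ}
    (h : LatSplit s R n) {l : LateralNode} (hl : s.lat[n + 1]? = some l) (hrow : l.row = R + 1) :
    LatSplit s (R + 1) (n + 1) := by
  obtain ⟨hn, rfl⟩ := List.getElem?_eq_some_iff.1 hl
  refine ⟨hn, fun j l hj => ?_⟩
  have hRj := h.2 j l hj
  obtain ⟨hj', rfl⟩ := List.getElem?_eq_some_iff.1 hj
  rcases lt_trichotomy j (n + 1) with hlt | rfl | hgt
  · have := List.pairwise_iff_getElem.1 hs.lat_sorted _ _ hj' hn hlt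
    constructor <;> intro <;> omega
  · constructor <;> intro <;> omega
  · have := List.pairwise_iff_getElem.1 hs.lat_sorted _ _ hn hj' hgt
    constructor <;> intro <;> omega

theorem LatSplit.succ_of_ne {wd : ℕ → ℕ} {s : State T N α} (hs : MemInv wd s) {R n : ℕ}
    (h : LatSplit s R n) (hl : ∀ l, s.lat[n + 1]? = some l → l.row ≠ R + 1) :
    LatSplit s (R + 1) n := by
  refine ⟨h.1, fun j l hj => ?_⟩
  have hRj := h.2 j l hj
  refine ⟨fun hrow => ?_, fun hle => (hRj.2 hle).trans (Nat.le_succ _)⟩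
  by_contra! hlt
  obtain ⟨hj', rfl⟩ := List.getElem?_eq_some_iff.1 hj
  have hn : s.lat[n + 1]? = some (s.lat[n + 1]'(by omega)) := List.getElem?_eq_getElem (by omega)
  have h₁ := hl _ hn
  have h₂ := h.2 _ _ hn
  rcases Nat.lt_or_ge (n + 1) j with h | h
  · have := List.pairwise_iff_getElem.1 hs.lat_sorted _ _ (by omega) hj' h
    omega
  · obtain rfl : j = n + 1 := by omega
    omega

/-- The width is constant between the rows `R` and `b` when the next Lateral node is above `b`. -/
theorem LatSplit.wd_eq {wd : ℕ → ℕ} {s : State T N α} (hs : MemInv wd s) {R n b : ℕ}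
    (h : LatSplit s R n) (hl : ∀ l, s.lat[n + 1]? = some l → b < l.row) (hb : b ≤ s.tail.max)
    {r : ℕ} (hr : R ≤ r) (hr' : r ≤ b) : wd r = wd R := by
  refine hs.wd_const hr (hr'.trans hb) fun l hlm hlR => ?_
  obtain ⟨j, hj', rfl⟩ := List.getElem_of_mem hlm
  have h₁ := h.2 j _ (List.getElem?_eq_getElem hj')
  have hnj : n + 1 ≤ j := by omega
  have h₂ := hl _ (List.getElem?_eq_getElem (by omega))
  rcases hnj.lt_or_eq with h | rfl
  · have := List.pairwise_iff_getElem.1 hs.lat_sorted _ _ (by omega) hj' h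
    omega
  · omega

variable [DecidableEq T] {wd : ℕ → ℕ} {L : List (OpId × Ret α)} {Q : List (QueueItem N α)}
  {s s' : State T N α}

theorem Inv.step (h : Inv wd L Q s) (hstep : Step s s') : ∃ wd' L' Q', Inv wd' L' Q' s' := by
  have hs := h.mem
  have locals : ∀ {t l}, s.loc t = l → LocInv wd s l ∧ OpInv L s t l := by
    rintro t l rfl
    exact ⟨h.loc t, h.op t⟩
  have goto : ∀ {t l}, LocInv wd s l → OpInv L s t l →
      ∃ wd' L' Q', Inv wd' L' Q' (s.goto t l) :=
    fun hl hop => ⟨_, _, _, h.goto hl hop⟩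
  cases hstep with
  | configure d w hd => exact ⟨_, _, _, h.configure hd⟩
  | invokeEnq t v ht => exact ⟨_, _, _, h.invoke trivial fun _ => id⟩
  | invokeDeq t ht => exact ⟨_, _, _, h.invoke trivial fun _ => id⟩
  | respond t p r ht => exact ⟨_, _, _, h.respond ht⟩
  | enqRead t p v ht => exact goto ⟨.inl rfl, by simp⟩ (locals ht).2
  | enqRestart t p v W full ht => exact goto trivial (locals ht).2
  | enqSeeFull t p v W full i ht hi hrow =>
    obtain ⟨⟨h₁, h₂⟩, hop⟩ := locals ht
    exact goto ⟨h₁, by simpa [hrow] using h₂⟩ hop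
  | enqSeeRoom t p v W full i ht hi hrow =>
    obtain ⟨⟨h₁, h₂⟩, hop⟩ := locals ht
    exact goto ⟨h₁, h₂, hi, le_rfl, fun _ => hrow⟩ hop
  | enqSucceed t p v W full i n ht hn => exact ⟨_, h.enqSucceed ht hn⟩
  | enqFail t p v W full i n ht hn =>
    obtain ⟨⟨h₁, h₂, _⟩, hop⟩ := locals ht
    exact goto ⟨h₁, h₂⟩ hop
  | shiftTailSync t p v W full ht hfull hw =>
    obtain ⟨⟨h₁, h₂⟩, hop⟩ := locals ht
    exact goto ⟨h₁, fun i hi => h₂ i (hfull i hi), hw⟩ hop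
  | shiftTailNoSync t p v W full ht hfull hw =>
    obtain ⟨⟨h₁, h₂⟩, hop⟩ := locals ht
    exact goto ⟨h₁, fun i hi => h₂ i (hfull i hi), fun hne => absurd hw hne⟩ hop
  | tailSyncNeeded t p v W l ht hl hrow =>
    obtain ⟨⟨h₁, h₂, h₃⟩, hop⟩ := locals ht
    refine goto ⟨h₁, h₂, h₃, le_rfl, fun _ l' hl' => ?_, fun hne => absurd rfl hne⟩ hop
    obtain ⟨ys, hys⟩ := List.getLast?_eq_some_iff.1 hl
    have hsort := hs.lat_sorted
    rw [hys] at hl' hsort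
    rcases List.mem_append.1 hl' with hl' | hl'
    · exact ((List.pairwise_append.1 hsort).2.2 l' hl' l (by simp)).le.trans hrow
    · rwa [List.mem_singleton.1 hl']
  | tailSyncUnneeded t p v W l ht hl hrow =>
    obtain ⟨⟨h₁, h₂, h₃⟩, hop⟩ := locals ht
    refine goto ⟨h₁, h₂, ?_⟩ hop
    -- For the current window the last Lateral row is above the max but at most `max + 1`; an
    -- outdated window was synced before it was replaced.
    rcases h₁ with rfl | ⟨_, _, h₁⟩
    · have hmem := List.mem_of_getLast? hl
      exact fun _ => ⟨l, hmem, le_antisymm (hs.lat_le l hmem) hrow⟩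
    · exact h₁
  | tailLinkSucceed t p v W n ht hn =>
    obtain ⟨⟨h₁, h₂, h₃, _, h₅, _⟩, hop⟩ := locals ht
    have h₅ := h₅ hn
    -- An outdated window with a pending change has its node at `W.max + 1`, but all rows are at
    -- most `W.max`.
    obtain rfl : W = s.tail := by
      rcases h₁ with h₁ | ⟨_, _, h₁⟩
      · exact h₁
      · obtain ⟨l, hl, hrow⟩ := h₁ h₃
        have := h₅ l hl
        omega
    have g : Grows wd wd s { s.goto t (.tailDepth p v s.tail) with
        lat := s.lat ++ [⟨s.tail.max + 1, s.tail.nextWidth⟩] } :=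
      { tail := .inl rfl, head := .inl rfl, lat := .inr ⟨_, rfl, rfl⟩
        sub := fun _ => .refl _, wd_eq := fun _ _ => rfl }
    exact ⟨_, _, _, h.memory rfl ((hs.tailLink h₅).congr rfl rfl rfl rfl rfl hs.depthShared_pos)
      g rfl rfl ⟨.inl rfl, h₂, fun _ =>
        ⟨_, List.mem_append_right _ (List.mem_singleton_self _), rfl⟩⟩ hop⟩
  | tailLinkFail t p v W n ht hn =>
    obtain ⟨⟨h₁, h₂, _, _, _, h₆⟩, hop⟩ := locals ht
    exact goto ⟨h₁, h₂, fun _ => h₆ hn⟩ hop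
  | tailReadDepth t p v W ht =>
    obtain ⟨⟨h₁, h₂, h₃⟩, hop⟩ := locals ht
    exact goto ⟨h₁, h₂, h₃, hs.depthShared_pos⟩ hop
  | tailReadWidth t p v W d ht =>
    obtain ⟨⟨h₁, h₂, h₃, h₄⟩, hop⟩ := locals ht
    exact goto ⟨h₁, h₂, h₃, h₄, rfl, rfl⟩ hop
  | tailCasSucceed t p v W W' ht hW =>
    obtain ⟨⟨_, h₂, h₃, h₄, h₅, h₆⟩, hop⟩ := locals ht
    subst hW
    obtain ⟨wd', hmem, g⟩ := hs.tailCas h₂ h₃ h₄ h₅ h₆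
    exact ⟨_, _, _, h.memory rfl (hmem.congr rfl rfl rfl rfl rfl hs.depthShared_pos)
      (g.congr rfl rfl rfl rfl) rfl rfl trivial hop⟩
  | tailCasFail t p v W W' ht hW => exact goto trivial (locals ht).2
  | deqRead t p ht => exact goto ⟨.inl rfl, by simp⟩ (locals ht).2
  | deqRestart t p W full ht => exact goto trivial (locals ht).2
  | deqSeeFull t p W full i ht hi hrow =>
    obtain ⟨⟨h₁, h₂⟩, hop⟩ := locals ht
    exact goto ⟨h₁, by simpa [hrow] using h₂⟩ hop
  | deqSeeItem t p W full i ht hi hrow hne =>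
    obtain ⟨⟨h₁, h₂⟩, hop⟩ := locals ht
    exact goto ⟨h₁, h₂, hi, le_rfl, fun _ => hrow⟩ hop
  | deqSucceed t p W full i n x ht hn hx => exact ⟨_, h.deqSucceed ht hn hx⟩
  | deqFail t p W full i n ht hn =>
    obtain ⟨⟨h₁, h₂, _⟩, hop⟩ := locals ht
    exact goto ⟨h₁, h₂⟩ hop
  | collectStart t p W full ht =>
    obtain ⟨⟨h₁, _⟩, hop⟩ := locals ht
    exact goto ⟨h₁, by simp⟩ hop
  | collectSee t p W c i ht hi hc he =>
    obtain ⟨⟨h₁, h₂⟩, hop⟩ := locals ht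
    refine goto ⟨h₁, fun j k hj => ?_⟩ hop
    by_cases hji : j = i
    · subst hji
      rw [Function.update_self] at hj
      exact (Option.some.inj hj).ge
    · rw [Function.update_of_ne hji] at hj
      exact h₂ j k hj
  | collectAbort t p W c ht => exact goto trivial (locals ht).2
  | recollectStart t p W c ht hc =>
    obtain ⟨L', h'⟩ := h.recollectStart ht hc
    exact ⟨_, _, _, h'⟩
  | recollectSee t p W c again i ht hi he hc =>
    obtain ⟨_, hp, hop⟩ := locals ht
    refine goto trivial ⟨hp, hop.imp_right fun ⟨hL, hf⟩ => ⟨hL, hf.imp_right ?_⟩⟩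
    -- The witness `j` cannot pass the second look: its recorded count would equal the removals of
    -- an empty sub-queue, yet it is below the length.
    rintro ⟨j, h₁, h₂, h₃⟩
    refine ⟨j, h₁, ?_, h₃⟩
    rintro (rfl | hj)
    · exact absurd (h₃ _ hc) (not_lt.2 he)
    · exact h₂ hj
  | recollectAbort t p W c again ht =>
    obtain ⟨L', h'⟩ := h.recollectAbort ht
    exact ⟨_, _, _, h'⟩
  | returnEmpty t p W c again ht hall hmax =>
    obtain ⟨_, hp, hop⟩ := locals ht
    refine goto trivial ⟨⟨_, hp⟩, ?_⟩
    rcases hop with hop | ⟨_, hf | ⟨j, h₁, h₂, _⟩⟩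
    · exact hop
    · omega
    · exact absurd (hall j h₁) h₂
  | shiftHead t p W full ht hfull =>
    obtain ⟨⟨h₁, h₂⟩, hop⟩ := locals ht
    exact goto ⟨h₁, fun i hi => h₂ i (hfull i hi)⟩ hop
  | headSeeStale t p W l ht hl hrow =>
    obtain ⟨⟨h₁, h₂⟩, hop⟩ := locals ht
    exact goto ⟨h₁, h₂, l, hl, hrow⟩ hop
  | headSeeClean t p W ht hl =>
    obtain ⟨⟨h₁, h₂⟩, hop⟩ := locals ht
    refine goto ⟨h₁, h₂, ?_⟩ hop
    rintro rfl
    exact latSplit_of_clean hs hl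
  | headPopSucceed t p W n ht hn =>
    obtain ⟨⟨h₁, h₂, l, hl, hrow⟩, hop⟩ := locals ht
    subst hn
    have g : Grows wd wd s { s.goto t (.headClean p W) with latHead := s.latHead + 1 } :=
      .of_eq rfl rfl rfl rfl
    -- Even a thread with an outdated `W` pops only nodes that are stale for the current head
    -- window, because `W.max ≤ s.head.max`.
    exact ⟨_, _, _, h.memory rfl ((hs.headPop hl (hrow.trans h₁.max_le)).congr rfl rfl rfl rfl rfl
      hs.depthShared_pos) g rfl rfl (g.locInv hs (l := .headClean p W) ⟨h₁, h₂⟩) hop⟩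
  | headPopFail t p W n ht hn =>
    obtain ⟨⟨h₁, h₂, _⟩, hop⟩ := locals ht
    exact goto ⟨h₁, h₂⟩ hop
  | headCaughtUp t p W n ht hmax => exact goto trivial (locals ht).2
  | headReadTail t p W n ht hmax =>
    obtain ⟨⟨h₁, h₂, h₃⟩, hop⟩ := locals ht
    exact goto ⟨h₁, h₂, hmax, le_rfl, h₃⟩ hop
  | headReadDepth t p W n M ht =>
    obtain ⟨⟨h₁, h₂, h₃, h₄, h₅⟩, hop⟩ := locals ht
    have := hs.depthShared_pos
    exact goto ⟨h₁, h₂, by omega, by omega, h₅⟩ hop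
  | headWidthChange t p W n m l ht hl hrow =>
    obtain ⟨⟨h₁, h₂, h₃, h₄, h₅⟩, hop⟩ := locals ht
    refine goto ⟨h₁, h₂, h₃, h₄, fun hW => ⟨(h₅ hW).succ_of_eq hs hl hrow, ?_⟩⟩ hop
    rw [← hrow, hs.lat_wd l (List.mem_of_getElem? hl) (by omega)]
  | headWidthKeep t p W n m ht hl =>
    obtain ⟨⟨h₁, h₂, h₃, h₄, h₅⟩, hop⟩ := locals ht
    refine goto ⟨h₁, h₂, h₃, h₄, fun hW => ?_⟩ hop
    have h₅ := h₅ hW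
    refine ⟨h₅.succ_of_ne hs hl, ?_⟩
    subst hW
    have hp := hs.head_pos
    have hle := hs.head_le
    rw [← hs.wd_head s.head.max (by omega) le_rfl]
    refine (hs.wd_succ _ (by omega) fun l' hl' hrow => ?_).symm
    obtain ⟨j, hj, rfl⟩ := List.getElem_of_mem hl'
    have h₆ := (h₅.succ_of_ne hs hl).2 j _ (List.getElem?_eq_getElem hj)
    have h₇ := h₅.2 j _ (List.getElem?_eq_getElem hj)
    omega
  | headLimitCut t p W n m w l ht hl hrow =>
    obtain ⟨⟨h₁, h₂, h₃, h₄, h₅⟩, hop⟩ := locals ht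
    refine goto ⟨h₁, h₂, fun hW => ?_⟩ hop
    obtain ⟨hsplit, rfl⟩ := h₅ hW
    -- The next node lies strictly above `W.max + 1`, so the cut window keeps at least one row.
    have h₆ := hsplit.2 _ _ hl
    refine ⟨by dsimp only; omega, by dsimp only; omega, rfl, fun r hr hr' => ?_⟩
    dsimp only at hr'
    refine hsplit.wd_eq hs (b := l.row - 1) (fun l' hl' => ?_) (by omega) hr hr'
    obtain rfl := Option.some.inj (hl.symm.trans hl')
    omega
  | headLimitKeep t p W n m w ht hl =>
    obtain ⟨⟨h₁, h₂, h₃, h₄, h₅⟩, hop⟩ := locals ht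
    refine goto ⟨h₁, h₂, fun hW => ?_⟩ hop
    obtain ⟨hsplit, rfl⟩ := h₅ hW
    exact ⟨h₃, h₄, rfl, fun r hr hr' => hsplit.wd_eq hs hl h₄ hr hr'⟩
  | headCasSucceed t p W W' ht hW =>
    obtain ⟨⟨_, h₂, h₃⟩, hop⟩ := locals ht
    subst hW
    obtain ⟨h₄, h₅, h₆, h₇⟩ := h₃ rfl
    obtain ⟨hmem, g⟩ := hs.headCas h₂ h₄ h₅ h₆ h₇
    exact ⟨_, _, _, h.memory rfl (hmem.congr rfl rfl rfl rfl rfl hs.depthShared_pos)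
      (g.congr rfl rfl rfl rfl) rfl rfl trivial hop⟩
  | headCasFail t p W W' ht hW => exact goto trivial (locals ht).2

theorem exists_inv_of_reachable {d w : ℕ} (hd : 1 ≤ d)
    (h : Relation.ReflTransGen Step (initial T N α d w) s) : ∃ wd L Q, Inv wd L Q s := by
  induction h with
  | refl => exact ⟨_, _, _, .initial hd⟩
  | tail _ hstep ih =>
    obtain ⟨wd, L, Q, h⟩ := ih
    exact h.step hstep

end Invariance

end ElasticQueue

/-- Every history of the elastic Lateral-plus-Window 2D queue is linearizable with respect to a FIFO
queue with elastic `k` out-of-order dequeues, where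
`k = (W^{enq x}.width - 1) * (W^{enq x}.depth + W^{deq x}.depth - 1)` for the dequeue of item `x`. -/
theorem theorem2 {T α : Type*} [DecidableEq T] (N d w : ℕ) (hd : 1 ≤ d) (hw : 1 ≤ w) (hwN : w ≤ N)
    (H : List (ElasticQueue.Event T α)) (hH : ElasticQueue.IsHistory N d w H) :
    ElasticQueue.Linearizable H
      (ElasticQueue.RelaxedFifo (ElasticQueue.Invokes H) (ElasticQueue.RankBound H)) := by
  obtain ⟨s, hs, rfl⟩ := hH
  obtain ⟨wd, L, Q, h⟩ := ElasticQueue.exists_inv_of_reachable hd hs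
  exact h.lin.linearizable
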